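/- **Setting.** Let $M$ be a real analytic manifold (Hausdorff, second countable, modelled on $\mathbb{R}^d$) with a volume density $dv$ which in every analytic chart reads $e^{2V(k)}\,dk_1\cdots dk_d$ with $V$ real analytic. Let $\mathcal{F}\to M$ be a real analytic Hilbert bundle, with complex Hilbert fibers $\mathcal{F}_k$. For every $k\in M$ let $H_0(k)$ be a self-adjoint operator in $\mathcal{F}_k$ such that $(H_0(k)+i)^{-1}$ is compact and is a real analytic section of $\mathcal{L}(\mathcal{F})$. Put $\Sigma=\{(k,\lambda)\in M\times\mathbb{R}:\lambda\in\mathrm{Spec}\,H_0(k)\}$ and assume that $p:\Sigma\to\mathbb{R}$, $(k,\lambda)\mapsto\lambda$, is proper. Let $\mathcal{S}$ be a locally finite partition of $\Sigma$ into connected embedded real analytic submanifolds of $M\times\mathbb{R}$ (strata) such that: $\overline{S}\cap S'\neq\emptyset$ implies $S'=S$ or $S'\subset\partial S:=\overline S\setminus S$; the multiplicity of $\lambda$ as an eigenvalue of $H_0(k)$ is constant on each stratum; and for each $S\in\mathcal{S}$ either $p(S)$ is an open interval and $dp|_{TS}$ has rank $1$ everywhere, or $p(S)$ is a single point and $dp|_{TS}=0$.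 Let $\tau$ be the union of the sets $p(S)$ over the strata on which $dp|_{TS}=0$. Let $I,\tilde I$ be open intervals with $I\Subset\tilde I\subset\mathbb{R}\setminus\tau$, and let $\mathcal{S}_I$ be the set of strata whose closure meets $p^{-1}(\overline I)$. **Covering.** Fix finitely many open sets $\omega_m\Subset M$ $(1\le m\le M_I)$, each contained in a coordinate chart in which $dv=e^{2V_m}dk$, and open intervals $J_{m,n}\Subset\tilde I$, for $(m,n)\in L(I)=\{(m,n):1\le m\le M_I,\ 1\le n\le N_m\}$. Put $\Omega_{m,n}=\omega_m\times J_{m,n}$ and $\pi_{m,n}(k)=1_{J_{m,n}}(H_0(k))$, and assume: 1. the sets $\Omega_{m,n}$ cover $p^{-1}(\overline I)$; 2. $J_{m,n}\cap J_{m,n'}=\emptyset$ for $n\ne n'$; 3. for each $(m,n)$ there is a (necessarily unique) stratum $S_{m,n}\in\mathcal{S}_I$, on which $dp$ has rank $1$, which meets $\Omega_{m,n}$ and such that $\Omega_{m,n}\cap\Sigma$ is a finite union of sets $\Omega_{m,n}\cap S'$ with $S'\in\mathcal{S}_I$ and $S_{m,n}\subset\overline{S'}$; 4. $\pi_{m,n}(k)$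 has constant rank $\mu_{m,n}$ on $\omega_m$, and there is an interval $J'_{m,n}\Subset J_{m,n}$ with $1_{J'_{m,n}}(H_0(k))=\pi_{m,n}(k)$ for all $k\in\omega_m$; 5. there is a real analytic section $W_{m,n}$ of $\mathcal{L}(\mathbb{C}^{\mu_{m,n}};\mathcal{F}|_{\omega_m})$ such that $W_{m,n}(k)$ is unitary from $\mathbb{C}^{\mu_{m,n}}$ onto $\mathrm{Ran}\,\pi_{m,n}(k)$, and $\tilde H_{m,n}=W_{m,n}^*H_0\pi_{m,n}W_{m,n}$ is real analytic on $\omega_m$; 6. there is a real analytic vector field $X_{m,n}$ on $\omega_m$ with $X_{m,n}\tilde H_{m,n}\ge\frac12\mathrm{Id}$; 7. if $\Omega_{m,n}\cap\Omega_{m',n'}\cap\Sigma\ne\emptyset$ and $\mu_{m,n}\ge\mu_{m',n'}$, then $\pi_{m,n}\pi_{m',n'}=\pi_{m',n'}$ on $\omega_m\cap\omega_{m'}$, and one of the following holds: $S_{m,n}\subset\partial S_{m',n'}$; or $S_{m',n'}\subset\partial S_{m,n}$ and $\mu_{m,n}=\mu_{m',n'}$; or $S_{m',n'}=S_{m,n}$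 and $\mu_{m,n}=\mu_{m',n'}$. **Partition of unity.** Fix real functions $g_m\in\mathcal{C}^\infty_{comp}(\omega_m)$ with $\sum_m g_m^2\equiv1$ near $\{k:\exists\lambda\in\overline I,\ (k,\lambda)\in\Sigma\}$, and $\chi_{m,n}\in\mathcal{C}^\infty_{comp}(J_{m,n})$ with $\chi_{m,n}\equiv1$ near $\overline{J'_{m,n}}$, such that $\sum_{(m,n)\in L(I)}g_m(k)^2\chi_{m,n}(\lambda)^2\equiv1$ on a neighborhood of $p^{-1}(\overline I)$ in $M\times\mathbb{R}$. **Connections.** A unitary connection on $\pi_{m,n}\mathcal{F}\to\omega_m$ is a connection compatible with the metric $\langle\cdot,\cdot\rangle e^{2V_m}$; it acts on endomorphisms by $(\nabla_XA)s=\nabla_X(As)-A\nabla_Xs$. Let $\nabla^{m,n}$ be the one given by $\nabla^{m,n}_X=W_{m,n}XW_{m,n}^*+dV_m(X)$. **Proposition.** There exist unitary connections $\tilde\nabla^{m,n}$ on $\pi_{m,n}\mathcal{F}\to\omega_m$, $(m,n)\in L(I)$, such that: * for all pairs $(m,n),(m',n')\in L(I)$ (in particular those with $\Omega_{m,n}\cap\Omega_{m',n'}\cap\Sigma\neq\emptyset$),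 $\tilde\nabla^{m,n}(\pi_{m,n}\pi_{m',n'})=0$ above $\mathrm{supp}\,g_m\cap\mathrm{supp}\,g_{m'}$; * for every $(m,n)\in L(I)$ and every $(k_0,\lambda_0)\in\Omega_{m,n}\cap p^{-1}(\overline I)$, if $\{(m',n')\in L(I):(k_0,\lambda_0)\in\Omega_{m',n'}\}=\{(m_\ell,n_\ell):1\le\ell\le L\}$ is ordered so that $\overline{S_{m_\ell,n_\ell}}\subset\overline{S_{m_{\ell+1},n_{\ell+1}}}$ for all $\ell<L$, then there is an open neighborhood $\mathcal{V}_{k_0}\subset\omega_m\cap\omega_{m_L}$ of $k_0$ with $$\pi_{m_L,n_L}\circ\tilde\nabla^{m,n}\circ\pi_{m_L,n_L}=\pi_{m_L,n_L}\circ\nabla^{m,n}\circ\pi_{m_L,n_L}\quad\text{on }\mathcal{V}_{k_0}.$$ -/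

import Mathlib

open Set Filter Topology MeasureTheory
open scoped ContDiff Manifold InnerProductSpace

noncomputable section

namespace FiberedOp

/-! ### Intervals -/

/-- Nonempty open intervals of the real line (possibly unbounded). -/
def IsOpenInterval (A : Set ℝ) : Prop := IsOpen A ∧ A.OrdConnected ∧ A.Nonempty

/-- `A ⋐ B`: the closure of `A` is compact and contained in `B`. -/
def CompactlyIn {X : Type*} [TopologicalSpace X] (A B : Set X) : Prop :=
  IsCompact (closure A) ∧ closure A ⊆ B

/-! ### Unbounded operators -/

section Operators

variable {E : Type*} [NormedAddCommGroup E] [InnerProductSpace ℂ E]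

/-- The spectrum of a closed operator `T`: the `z` for which `T - z : D(T) → E` is not bijective
(for closed `T` the inverse is automatically bounded). -/
def pmapSpectrum (T : E →ₗ.[ℂ] E) : Set ℂ :=
  {z | ¬ Function.Bijective (fun v : T.domain => T v - z • (v : E))}

/-- `ker (T - z)`, as a subspace of the whole space. -/
def eigenspace (T : E →ₗ.[ℂ] E) (z : ℂ) : Submodule ℂ E :=
  (LinearMap.ker (T.toFun - z • T.domain.subtype)).map T.domain.subtype

/-- The spectral projection `1_J(T)` of a self-adjoint operator with compact resolvent:
the orthogonal projection onto the closed span of the eigenvectors with eigenvalue in `J`. -/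
def spectralProj [CompleteSpace E] (T : E →ₗ.[ℂ] E) (J : Set ℝ) : E →L[ℂ] E :=
  (⨆ l ∈ J, eigenspace T (l : ℂ)).topologicalClosure.starProjection

end Operators

section Manifold

variable {d : ℕ} {M : Type*} [TopologicalSpace M] [ChartedSpace (EuclideanSpace ℝ (Fin d)) M]

/-! ### Embedded analytic submanifolds of `M × ℝ` and stratifications -/

/-- The model with corners of `M × ℝ`, where `M` is modelled on `ℝ^d`. -/
abbrev prodModel (d : ℕ) :=
  (𝓘(ℝ, EuclideanSpace ℝ (Fin d))).prod 𝓘(ℝ, ℝ)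

/-- `e` is an analytic chart of `M × ℝ` at `x` in which `S` is the trace of the linear
subspace `W`. -/
def IsSliceChart (S : Set (M × ℝ)) (x : M × ℝ)
    (e : OpenPartialHomeomorph (M × ℝ) (ModelProd (EuclideanSpace ℝ (Fin d)) ℝ))
    (W : Submodule ℝ (EuclideanSpace ℝ (Fin d) × ℝ)) : Prop :=
  e ∈ IsManifold.maximalAtlas (prodModel d) ω (M × ℝ) ∧ x ∈ e.source ∧
    ∀ y ∈ e.source, y ∈ S ↔ e.extend (prodModel d) y ∈ W

variable (d) in
/-- `S` is an embedded real analytic submanifold of `M × ℝ`. -/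
def IsEmbeddedAnalytic (S : Set (M × ℝ)) : Prop :=
  ∀ x ∈ S, ∃ e W, IsSliceChart (d := d) S x e W

variable (d) in
/-- The tangent space `T_x S` of an embedded submanifold `S ⊆ M × ℝ` at `x ∈ S`. -/
def tangentSet (S : Set (M × ℝ)) (x : M × ℝ) : Set (TangentSpace (prodModel d) x) :=
  {v | ∃ e W, IsSliceChart (d := d) S x e W ∧
    mfderiv (prodModel d) 𝓘(ℝ, EuclideanSpace ℝ (Fin d) × ℝ) (e.extend (prodModel d)) x v ∈ W}

variable (d) in
/-- The restriction to `S` of the projection `M × ℝ → ℝ` has rank `1` everywhere. -/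
def RankOne (S : Set (M × ℝ)) : Prop :=
  ∀ x ∈ S, ∃ v ∈ tangentSet d S x,
    mfderiv (prodModel d) 𝓘(ℝ, ℝ) (Prod.snd : M × ℝ → ℝ) x v ≠ 0

variable (d) in
/-- The restriction to `S` of the projection `M × ℝ → ℝ` has rank `0` everywhere. -/
def RankZero (S : Set (M × ℝ)) : Prop :=
  ∀ x ∈ S, ∀ v ∈ tangentSet d S x,
    mfderiv (prodModel d) 𝓘(ℝ, ℝ) (Prod.snd : M × ℝ → ℝ) x v = 0

variable {F : M → Type*} [∀ k, NormedAddCommGroup (F k)] [∀ k, InnerProductSpace ℂ (F k)]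

/-- The characteristic variety `Σ = {(k, l) : l ∈ Spec H₀(k)}`. -/
def charVariety (H₀ : ∀ k, F k →ₗ.[ℂ] F k) : Set (M × ℝ) :=
  {x | (x.2 : ℂ) ∈ pmapSpectrum (H₀ x.1)}

/-- `p_{Σ → ℝ}⁻¹(A)`. -/
def charVarietyOver (H₀ : ∀ k, F k →ₗ.[ℂ] F k) (A : Set ℝ) : Set (M × ℝ) :=
  {x | x ∈ charVariety H₀ ∧ x.2 ∈ A}

variable (d) in
/-- `𝒮` is a locally finite stratification of `Σ` compatible with `p_{Σ → ℝ}`. -/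
structure IsStratification (H₀ : ∀ k, F k →ₗ.[ℂ] F k) (𝒮 : Set (Set (M × ℝ))) : Prop where
  sUnion_eq : ⋃₀ 𝒮 = charVariety H₀
  disjoint : 𝒮.PairwiseDisjoint id
  locallyFinite : LocallyFinite (fun S : 𝒮 => (S : Set (M × ℝ)))
  connected : ∀ S ∈ 𝒮, IsConnected S
  embedded : ∀ S ∈ 𝒮, IsEmbeddedAnalytic d S
  frontier : ∀ S ∈ 𝒮, ∀ S' ∈ 𝒮, (closure S ∩ S').Nonempty → S' = S ∨ S' ⊆ closure S \ S
  multiplicity : ∀ S ∈ 𝒮, ∃ μ : ℕ, ∀ x ∈ S,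
    Module.finrank ℂ (eigenspace (H₀ x.1) (x.2 : ℂ)) = μ
  rank : ∀ S ∈ 𝒮, (IsOpenInterval (Prod.snd '' S) ∧ RankOne d S) ∨
    ((∃ l, Prod.snd '' S = {l}) ∧ RankZero d S)

variable (d) in
/-- The set `τ` of thresholds: the images of the strata on which the rank is `0`. -/
def thresholds (𝒮 : Set (Set (M × ℝ))) : Set ℝ :=
  ⋃ S ∈ {S ∈ 𝒮 | RankZero d S}, Prod.snd '' S

/-- The strata whose closure meets `p_{Σ → ℝ}⁻¹(closure I)`. -/
def strataOver (H₀ : ∀ k, F k →ₗ.[ℂ] F k) (𝒮 : Set (Set (M × ℝ))) (I : Set ℝ) :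
    Set (Set (M × ℝ)) :=
  {S ∈ 𝒮 | (closure S ∩ charVarietyOver H₀ (closure I)).Nonempty}

/-! ### Volume densities -/

/-- In the chart `e`, the measure `ν` is `e^{2V} dk₁ ⋯ dk_d`, with `V` real analytic. -/
def IsHalfLogDensity [MeasurableSpace M] (ν : Measure M)
    (e : OpenPartialHomeomorph M (EuclideanSpace ℝ (Fin d))) (V : M → ℝ) : Prop :=
  ContMDiffOn 𝓘(ℝ, EuclideanSpace ℝ (Fin d)) 𝓘(ℝ, ℝ) ω V e.source ∧
    ∀ B ⊆ e.source, MeasurableSet B →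
      ν B = ∫⁻ y in e '' B, ENNReal.ofReal (Real.exp (2 * V (e.symm y)))

variable (d) in
/-- `ν` is a real analytic volume density on `M`. -/
def IsAnalyticDensity [MeasurableSpace M] (ν : Measure M) : Prop :=
  ∀ e ∈ IsManifold.maximalAtlas 𝓘(ℝ, EuclideanSpace ℝ (Fin d)) ω M,
    ∃ V : M → ℝ, IsHalfLogDensity ν e V

/-! ### Real analytic Hilbert bundles -/

variable (d F) in
/-- A structure of real analytic Hilbert bundle with model fiber `H'` on the family `F` of complex
Hilbert spaces: fiberwise unitary trivializations over the members of an open covering of `M`, with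
norm-analytic transition maps. The values of `triv i` outside `base i` play no role. -/
structure HilbertBundle (H' : Type*) [NormedAddCommGroup H'] [InnerProductSpace ℂ H'] where
  ι : Type
  base : ι → Set M
  isOpen_base : ∀ i, IsOpen (base i)
  cover : ∀ k, ∃ i, k ∈ base i
  triv : ι → ∀ k, F k ≃ₗᵢ[ℂ] H'
  transition : ∀ i j, ContMDiffOn 𝓘(ℝ, EuclideanSpace ℝ (Fin d)) 𝓘(ℝ, H' →L[ℂ] H') ω
    (fun k => (((triv i k).symm.trans (triv j k)).toContinuousLinearEquiv : H' →L[ℂ] H'))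
    (base i ∩ base j)

variable {H' : Type*} [NormedAddCommGroup H'] [InnerProductSpace ℂ H']

namespace HilbertBundle

/-- `s` is a smooth section of `F` over the set `U` (its values outside `U` are irrelevant). -/
def SmoothOn (𝓑 : HilbertBundle d F H') (U : Set M) (s : ∀ k, F k) : Prop :=
  ∀ i, ContMDiffOn 𝓘(ℝ, EuclideanSpace ℝ (Fin d)) 𝓘(ℝ, H') ∞
    (fun k => 𝓑.triv i k (s k)) (U ∩ 𝓑.base i)

/-- `A` is a real analytic section of `ℒ(F)` over `U`. -/
def EndAnalyticOn (𝓑 : HilbertBundle d F H') (U : Set M) (A : ∀ k, F k →L[ℂ] F k) : Prop :=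
  ∀ i, ContMDiffOn 𝓘(ℝ, EuclideanSpace ℝ (Fin d)) 𝓘(ℝ, H' →L[ℂ] H') ω
    (fun k => ((𝓑.triv i k).toContinuousLinearEquiv : F k →L[ℂ] H') ∘L A k ∘L
      ((𝓑.triv i k).symm.toContinuousLinearEquiv : H' →L[ℂ] F k)) (U ∩ 𝓑.base i)

/-- `W` is a real analytic section of `ℒ(ℂ^μ; F)` over `U`. -/
def FrameAnalyticOn (𝓑 : HilbertBundle d F H') (U : Set M) {μ : ℕ}
    (W : ∀ k, EuclideanSpace ℂ (Fin μ) →L[ℂ] F k) : Prop :=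
  ∀ i, ContMDiffOn 𝓘(ℝ, EuclideanSpace ℝ (Fin d))
    𝓘(ℝ, EuclideanSpace ℂ (Fin μ) →L[ℂ] H') ω
    (fun k => ((𝓑.triv i k).toContinuousLinearEquiv : F k →L[ℂ] H') ∘L W k) (U ∩ 𝓑.base i)

/-- `s` is a smooth section over `U` of the subbundle `π F`, the range of the projections `π k`. -/
def SubSection (𝓑 : HilbertBundle d F H') (π : ∀ k, F k →L[ℂ] F k) (U : Set M)
    (s : ∀ k, F k) : Prop :=
  𝓑.SmoothOn U s ∧ ∀ k ∈ U, s k ∈ LinearMap.range (π k : F k →ₗ[ℂ] F k)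

end HilbertBundle

/-! ### Analytically fibered operators -/

/-- `H₀` is an analytically fibered family of self-adjoint operators: the resolvent
`(H₀(k) + i)⁻¹` is compact and real analytic in `k`, and `p_{Σ → ℝ}` is proper. -/
structure IsAnalyticallyFibered [∀ k, CompleteSpace (F k)] (𝓑 : HilbertBundle d F H')
    (H₀ : ∀ k, F k →ₗ.[ℂ] F k) : Prop where
  selfAdjoint : ∀ k, IsSelfAdjoint (H₀ k)
  resolvent : ∃ R : ∀ k, F k →L[ℂ] F k,
    (∀ k v, ∃ h : R k v ∈ (H₀ k).domain, H₀ k ⟨R k v, h⟩ + Complex.I • R k v = v) ∧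
    (∀ k, IsCompactOperator (R k)) ∧ 𝓑.EndAnalyticOn Set.univ R
  proper : IsProperMap (fun x : charVariety H₀ => x.1.2)

/-! ### Unitary connections on subbundles -/

/-- The differential at `k` of a function `f` on `M` with values in a normed space. -/
def diffAt {G : Type*} [NormedAddCommGroup G] [NormedSpace ℝ G] (f : M → G) (k : M) :
    TangentSpace 𝓘(ℝ, EuclideanSpace ℝ (Fin d)) k →L[ℝ] G :=
  mfderiv 𝓘(ℝ, EuclideanSpace ℝ (Fin d)) 𝓘(ℝ, G) f k

/-- Covariant derivatives `D s k v = (∇_v s)(k)`, for sections `s` and tangent vectors `v` at `k`.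
Only the values on smooth sections, over open sets, of the bundle under consideration matter. -/
abbrev Cov (d : ℕ) {M : Type*} [TopologicalSpace M] [ChartedSpace (EuclideanSpace ℝ (Fin d)) M]
    (F : M → Type*) [∀ k, NormedAddCommGroup (F k)] [∀ k, InnerProductSpace ℂ (F k)] :=
  (∀ k, F k) → ∀ k, TangentSpace 𝓘(ℝ, EuclideanSpace ℝ (Fin d)) k →L[ℝ] F k

/-- `D` is a unitary connection on the bundle `π F → O` (with `π` a family of projections) endowed
with the metric `⟨·,·⟩ e^{2V}`: for each open `U ⊆ O` it maps smooth sections of `π F` over `U` to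
smooth `1`-forms over `U` with values in `π F`, it is `ℂ`-linear, satisfies the Leibniz rule, and is
compatible with the metric. (The Leibniz rule with `f` the indicator function of the complement of
`U` shows that `D s` over `U` depends only on the restriction of `s` to `U`.) -/
structure IsUnitaryConnection [IsManifold 𝓘(ℝ, EuclideanSpace ℝ (Fin d)) 1 M]
    (𝓑 : HilbertBundle d F H') (O : Set M)
    (π : ∀ k, F k →L[ℂ] F k) (V : M → ℝ) (D : Cov d F) : Prop where
  maps : ∀ U ⊆ O, IsOpen U → ∀ s, 𝓑.SubSection π U s →
    ∀ X : ∀ k : M, TangentSpace 𝓘(ℝ, EuclideanSpace ℝ (Fin d)) k,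
      ContMDiffOn 𝓘(ℝ, EuclideanSpace ℝ (Fin d)) (𝓘(ℝ, EuclideanSpace ℝ (Fin d))).tangent ∞
        (fun k => (⟨k, X k⟩ : TangentBundle 𝓘(ℝ, EuclideanSpace ℝ (Fin d)) M)) U →
      𝓑.SubSection π U (fun k => D s k (X k))
  add : ∀ U ⊆ O, IsOpen U → ∀ s t, 𝓑.SubSection π U s → 𝓑.SubSection π U t →
    ∀ k ∈ U, D (fun k => s k + t k) k = D s k + D t k
  smul : ∀ U ⊆ O, IsOpen U → ∀ (c : ℂ) (s), 𝓑.SubSection π U s →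
    ∀ k ∈ U, ∀ v, D (fun k => c • s k) k v = c • D s k v
  leibniz : ∀ U ⊆ O, IsOpen U → ∀ (f : M → ℝ) (s),
    ContMDiffOn 𝓘(ℝ, EuclideanSpace ℝ (Fin d)) 𝓘(ℝ, ℝ) ∞ f U → 𝓑.SubSection π U s →
    ∀ k ∈ U, ∀ v, D (fun k => f k • s k) k v =
      diffAt f k v • s k + f k • D s k v
  unitary : ∀ U ⊆ O, IsOpen U → ∀ s t, 𝓑.SubSection π U s → 𝓑.SubSection π U t →
    ∀ k ∈ U, ∀ v,
      diffAt (fun k => ⟪s k, t k⟫_ℂ * (Real.exp (2 * V k) : ℂ)) k v =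
      (⟪D s k v, t k⟫_ℂ + ⟪s k, D t k v⟫_ℂ) * (Real.exp (2 * V k) : ℂ)

/-- The connection induced on endomorphisms: `(∇_v A) s = ∇_v (A s) - A (∇_v s)`. -/
def endCov (D : Cov d F) (A : ∀ k, F k →L[ℂ] F k) (s : ∀ k, F k) (k : M)
    (v : TangentSpace 𝓘(ℝ, EuclideanSpace ℝ (Fin d)) k) : F k :=
  D (fun k => A k (s k)) k v - A k (D s k v)

/-- The connection `∇_X = W X W^* + dV(X)`. -/
def frameCov [∀ k, CompleteSpace (F k)] {μ : ℕ} (W : ∀ k, EuclideanSpace ℂ (Fin μ) →L[ℂ] F k)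
    (V : M → ℝ) : Cov d F := fun s k =>
  ((W k).restrictScalars ℝ) ∘L diffAt (fun k => ContinuousLinearMap.adjoint (W k) (s k)) k +
    (diffAt V k).smulRight (s k)

/-! ### Adapted coverings and partitions of unity -/

/-- A covering of `p_{Σ → ℝ}⁻¹(closure I)` by cylinders `Ω_{m,n} = ω_m × J_{m,n}` adapted to the
stratification `𝒮`, with the associated objects. Pairs `(m, n)` are `p : Σ m, Fin (N m)`, and
`dom m` stands for `ω_m`, a local chart open set on which the volume density is `e^{2V} dk`. -/
structure AdaptedCovering [IsManifold 𝓘(ℝ, EuclideanSpace ℝ (Fin d)) 1 M] [∀ k, CompleteSpace (F k)] [MeasurableSpace M]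
    (𝓑 : HilbertBundle d F H') (H₀ : ∀ k, F k →ₗ.[ℂ] F k) (ν : Measure M)
    (𝒮 : Set (Set (M × ℝ))) (I I' : Set ℝ) where
  num : ℕ
  N : Fin num → ℕ
  dom : Fin num → Set M
  J : (Σ m, Fin (N m)) → Set ℝ
  isOpen_dom : ∀ m, IsOpen (dom m)
  dom_compact : ∀ m, IsCompact (closure (dom m))
  J_interval : ∀ p, IsOpenInterval (J p)
  J_compact : ∀ p, CompactlyIn (J p) I'
  /-- A coordinate chart on `ω_m`, and the corresponding expression of the volume density. -/
  chart : Fin num → OpenPartialHomeomorph M (EuclideanSpace ℝ (Fin d))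
  chart_mem : ∀ m, chart m ∈ IsManifold.maximalAtlas 𝓘(ℝ, EuclideanSpace ℝ (Fin d)) ω M
  dom_subset : ∀ m, dom m ⊆ (chart m).source
  V : Fin num → M → ℝ
  V_density : ∀ m, IsHalfLogDensity ν (chart m) (V m)
  cover : charVarietyOver H₀ (closure I) ⊆ ⋃ p, dom p.1 ×ˢ J p
  J_disjoint : ∀ m n n', n ≠ n' → Disjoint (J ⟨m, n⟩) (J ⟨m, n'⟩)
  /-- The stratum `S_{m,n}`. It meets `Ω_{m,n}`, and this makes it unique. -/
  S : (Σ m, Fin (N m)) → Set (M × ℝ)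
  S_mem : ∀ p, S p ∈ strataOver H₀ 𝒮 I
  S_rank : ∀ p, RankOne d (S p)
  S_meets : ∀ p, (S p ∩ dom p.1 ×ˢ J p).Nonempty
  S_minimal : ∀ p, ∃ T ⊆ strataOver H₀ 𝒮 I, T.Finite ∧ (∀ S' ∈ T, S p ⊆ closure S') ∧
    (dom p.1 ×ˢ J p) ∩ charVariety H₀ = ⋃ S' ∈ T, (dom p.1 ×ˢ J p) ∩ S'
  μ : (Σ m, Fin (N m)) → ℕ
  rank_eq : ∀ p, ∀ k ∈ dom p.1,
    Module.finrank ℂ (LinearMap.range (spectralProj (H₀ k) (J p) : F k →ₗ[ℂ] F k)) = μ p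
  /-- The smaller interval `J'_{m,n} ⋐ J_{m,n}` which carries the same spectral projection. -/
  J' : (Σ m, Fin (N m)) → Set ℝ
  J'_interval : ∀ p, (J' p).OrdConnected
  J'_compact : ∀ p, CompactlyIn (J' p) (J p)
  J'_proj : ∀ p, ∀ k ∈ dom p.1, spectralProj (H₀ k) (J p) = spectralProj (H₀ k) (J' p)
  W : ∀ p, ∀ k, EuclideanSpace ℂ (Fin (μ p)) →L[ℂ] F k
  W_analytic : ∀ p, 𝓑.FrameAnalyticOn (dom p.1) (W p)
  W_isometry : ∀ p, ∀ k ∈ dom p.1, ∀ c, ‖W p k c‖ = ‖c‖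
  W_range : ∀ p, ∀ k ∈ dom p.1, LinearMap.range (W p k : EuclideanSpace ℂ (Fin (μ p)) →ₗ[ℂ] F k) =
    LinearMap.range (spectralProj (H₀ k) (J p) : F k →ₗ[ℂ] F k)
  /-- The matrix `W^* H₀(k) 1_J(H₀(k)) W`. -/
  Ht : ∀ p, M → (EuclideanSpace ℂ (Fin (μ p)) →L[ℂ] EuclideanSpace ℂ (Fin (μ p)))
  Ht_eq : ∀ p, ∀ k ∈ dom p.1, ∀ c, ∃ h : spectralProj (H₀ k) (J p) (W p k c) ∈ (H₀ k).domain,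
    ContinuousLinearMap.adjoint (W p k) (H₀ k ⟨spectralProj (H₀ k) (J p) (W p k c), h⟩) = Ht p k c
  Ht_analytic : ∀ p, ContMDiffOn 𝓘(ℝ, EuclideanSpace ℝ (Fin d))
    𝓘(ℝ, EuclideanSpace ℂ (Fin (μ p)) →L[ℂ] EuclideanSpace ℂ (Fin (μ p))) ω (Ht p) (dom p.1)
  X : (Σ m, Fin (N m)) → ∀ k : M, TangentSpace 𝓘(ℝ, EuclideanSpace ℝ (Fin d)) k
  X_analytic : ∀ p, ContMDiffOn 𝓘(ℝ, EuclideanSpace ℝ (Fin d))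
    (𝓘(ℝ, EuclideanSpace ℝ (Fin d))).tangent ω
    (fun k => (⟨k, X p k⟩ : TangentBundle 𝓘(ℝ, EuclideanSpace ℝ (Fin d)) M)) (dom p.1)
  /-- `X H̃ ≥ 1/2`; conjugation by `W` turns this into `[W X W^*] (H₀ 1_J(H₀)) ≥ 1/2 1_J(H₀)`. -/
  X_pos : ∀ p, ∀ k ∈ dom p.1,
    (diffAt (Ht p) k (X p k) -
      (1 / 2 : ℂ) • ContinuousLinearMap.id ℂ (EuclideanSpace ℂ (Fin (μ p)))).IsPositive
  overlap_proj : ∀ p q, ((dom p.1 ×ˢ J p) ∩ (dom q.1 ×ˢ J q) ∩ charVariety H₀).Nonempty →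
    μ q ≤ μ p → ∀ k ∈ dom p.1 ∩ dom q.1,
      spectralProj (H₀ k) (J p) ∘L spectralProj (H₀ k) (J q) = spectralProj (H₀ k) (J q)
  overlap_strata : ∀ p q, ((dom p.1 ×ˢ J p) ∩ (dom q.1 ×ˢ J q) ∩ charVariety H₀).Nonempty →
    μ q ≤ μ p →
      S p ⊆ closure (S q) \ S q ∨ (S q ⊆ closure (S p) \ S p ∧ μ p = μ q) ∨
        (S q = S p ∧ μ p = μ q)

namespace AdaptedCovering

variable [IsManifold 𝓘(ℝ, EuclideanSpace ℝ (Fin d)) 1 M]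
    [∀ k, CompleteSpace (F k)] [MeasurableSpace M]
    {𝓑 : HilbertBundle d F H'} {H₀ : ∀ k, F k →ₗ.[ℂ] F k} {ν : Measure M}
    {𝒮 : Set (Set (M × ℝ))} {I I' : Set ℝ}

/-- The set `L(I)` of pairs `(m, n)`. -/
abbrev Pairs (C : AdaptedCovering 𝓑 H₀ ν 𝒮 I I') := Σ m, Fin (C.N m)

/-- `Ω_{m,n} = ω_m × J_{m,n}`. -/
def cyl (C : AdaptedCovering 𝓑 H₀ ν 𝒮 I I') (p : C.Pairs) : Set (M × ℝ) := C.dom p.1 ×ˢ C.J p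

/-- `π_{m,n}(k) = 1_{J_{m,n}}(H₀(k))`. -/
def proj (C : AdaptedCovering 𝓑 H₀ ν 𝒮 I I') (p : C.Pairs) (k : M) : F k →L[ℂ] F k :=
  spectralProj (H₀ k) (C.J p)

/-- The original connection `∇^{m,n}_X = W_{m,n} X W_{m,n}^* + dV(X)` on `π_{m,n} F → ω_m`. -/
def nabla (C : AdaptedCovering 𝓑 H₀ ν 𝒮 I I') (p : C.Pairs) : Cov d F :=
  frameCov (C.W p) (C.V p.1)

/-- A partition of unity `(g_m)` subordinate to `(ω_m)`, with energy cut-offs `χ_{m,n}`. By the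
choice of the `χ_{m,n}`, automatically `g_m(k) 1_{J_{m,n}}(H₀(k)) = g_m(k) χ_{m,n}(H₀(k))`
for `k ∈ ω_m`. -/
structure PartitionOfUnity (C : AdaptedCovering 𝓑 H₀ ν 𝒮 I I') where
  g : Fin C.num → M → ℝ
  g_smooth : ∀ m, ContMDiff 𝓘(ℝ, EuclideanSpace ℝ (Fin d)) 𝓘(ℝ, ℝ) ∞ (g m)
  g_compact : ∀ m, HasCompactSupport (g m)
  g_support : ∀ m, tsupport (g m) ⊆ C.dom m
  sum_g : ∀ᶠ k in 𝓝ˢ (Prod.fst '' charVarietyOver H₀ (closure I)), ∑ m, g m k ^ 2 = 1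
  χ : C.Pairs → ℝ → ℝ
  χ_smooth : ∀ p, ContDiff ℝ ∞ (χ p)
  χ_compact : ∀ p, HasCompactSupport (χ p)
  χ_support : ∀ p, tsupport (χ p) ⊆ C.J p
  χ_eq_one : ∀ p, ∀ᶠ l in 𝓝ˢ (closure (C.J' p)), χ p l = 1
  sum_gχ : ∀ᶠ x in 𝓝ˢ (charVarietyOver H₀ (closure I)),
    ∑ p : C.Pairs, g p.1 x.1 ^ 2 * χ p x.2 ^ 2 = 1

end AdaptedCovering

end Manifold

end FiberedOp

end

/-! For a connection `D`, an orthogonal projection `Q` and a cut-off `θ`, replace `D` by `(1 - θ) D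
+ θ (Q D Q + (1 - Q) D (1 - Q))`. This discards a fraction `θ` of the off-diagonal part of `D`, so
`Q` becomes parallel where `θ = 1`. The connection stays unitary: the discarded terms cancel in the
metric identity, because `Q s` and `(1 - Q) t` are orthogonal (`IsUnitaryConnection.splitCov`). The
connection `∇^p` is split in this way along every `π_q` in turn, with `θ` equal to `1` on `supp g_m`
and supported in `ω_m`. All spectral projections of `H₀(k)` commute, so a later splitting does not
destroy what an earlier one made parallel (`ParallelAt.splitCov`). Hence every `π_q` is parallel
over `supp g_{m'}`, where `q = (m', n')`, and so is `π_p π_q`.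

For the compression to `π_r`, with `r` the last pair at `(k₀, l₀)`, splitting along `π_q` changes
nothing when, near `k₀`, `θ = 0`, or `π_q π_r = π_r`, or `π_q π_r = 0`. One of these always holds.
The support of `θ_m` is so small that the `J (m, n)` still cover the spectrum in `closure I` above
it (`PartitionOfUnity.exists_cutoff`). If `k₀ ∈ supp θ_m`, some cylinder `(m, n)` therefore contains
`(k₀, l₀)`, and nestedness of the strata gives `π_{m,n} π_r = π_r`
(`proj_comp_proj_of_closure_subset`). For `n' ≠ n`, disjointness of the intervals then gives
`π_{m,n'} π_r = 0`. -/

namespace FiberedOp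

/-! ### Spectral projections and eigenvectors of a self-adjoint operator -/

section SpectralProjections

variable {E : Type*} [NormedAddCommGroup E] [InnerProductSpace ℂ E]

theorem mem_eigenspace_iff {T : E →ₗ.[ℂ] E} {z : ℂ} {x : E} :
    x ∈ eigenspace T z ↔ ∃ h : x ∈ T.domain, T ⟨x, h⟩ = z • x := by
  simp only [eigenspace, Submodule.mem_map, LinearMap.mem_ker]
  constructor
  · rintro ⟨y, hy, rfl⟩
    refine ⟨y.2, ?_⟩
    simpa [sub_eq_zero] using hy
  · rintro ⟨h, hx⟩
    refine ⟨⟨x, h⟩, ?_, rfl⟩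
    simpa [sub_eq_zero] using hx

variable [CompleteSpace E]

theorem inner_apply_eq_of_isSelfAdjoint {T : E →ₗ.[ℂ] E} (hT : IsSelfAdjoint T)
    (x y : T.domain) : ⟪T x, (y : E)⟫_ℂ = ⟪(x : E), T y⟫_ℂ := by
  have h := LinearPMap.adjoint_isFormalAdjoint hT.dense_domain
  rw [LinearPMap.isSelfAdjoint_def.1 hT] at h
  exact h x y

theorem inner_eq_zero_of_mem_eigenspace {T : E →ₗ.[ℂ] E} (hT : IsSelfAdjoint T) {a b : ℝ}
    (hab : a ≠ b) {x y : E} (hx : x ∈ eigenspace T (a : ℂ)) (hy : y ∈ eigenspace T (b : ℂ)) :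
    ⟪x, y⟫_ℂ = 0 := by
  obtain ⟨h, hTx⟩ := mem_eigenspace_iff.1 hx
  obtain ⟨h', hTy⟩ := mem_eigenspace_iff.1 hy
  have := inner_apply_eq_of_isSelfAdjoint hT ⟨x, h⟩ ⟨y, h'⟩
  rw [hTx, hTy, inner_smul_left, inner_smul_right, Complex.conj_ofReal, ← sub_eq_zero,
    ← sub_mul] at this
  refine (mul_eq_zero.1 this).resolve_left ?_
  exact_mod_cast sub_ne_zero.2 hab

theorem spectralProj_idem (T : E →ₗ.[ℂ] E) (J : Set ℝ) (x : E) :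
    spectralProj T J (spectralProj T J x) = spectralProj T J x :=
  Submodule.starProjection_eq_self_iff.2 (Submodule.starProjection_apply_mem _ _)

theorem inner_spectralProj_left (T : E →ₗ.[ℂ] E) (J : Set ℝ) (x y : E) :
    ⟪spectralProj T J x, y⟫_ℂ = ⟪x, spectralProj T J y⟫_ℂ :=
  Submodule.inner_starProjection_left_eq_right _ _ _

theorem mem_range_spectralProj {T : E →ₗ.[ℂ] E} {J : Set ℝ} {x : E} :
    x ∈ LinearMap.range (spectralProj T J : E →ₗ[ℂ] E) ↔ spectralProj T J x = x :=
  ⟨by rintro ⟨y, rfl⟩; exact spectralProj_idem T J y, fun h => ⟨x, h⟩⟩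

theorem spectralProj_apply_of_mem {T : E →ₗ.[ℂ] E} {J : Set ℝ} {l : ℝ} (hl : l ∈ J) {x : E}
    (hx : x ∈ eigenspace T (l : ℂ)) : spectralProj T J x = x := by
  refine Submodule.starProjection_eq_self_iff.2 (Submodule.le_topologicalClosure _ ?_)
  exact Submodule.mem_iSup_of_mem l (Submodule.mem_iSup_of_mem hl hx)

theorem spectralProj_apply_of_forall_inner {T : E →ₗ.[ℂ] E} {J : Set ℝ} {x : E}
    (h : ∀ l ∈ J, ∀ y ∈ eigenspace T (l : ℂ), ⟪y, x⟫_ℂ = 0) : spectralProj T J x = 0 := by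
  refine (Submodule.starProjection_apply_eq_zero_iff _).2 ?_
  rw [Submodule.orthogonal_closure]
  refine (Submodule.mem_orthogonal _ _).2 fun y hy => ?_
  rw [← Submodule.mem_orthogonal_singleton_iff_inner_left]
  refine (iSup₂_le fun l hl z hz => ?_ :
    (⨆ l ∈ J, eigenspace T (l : ℂ)) ≤ (Submodule.span ℂ {x})ᗮ) hy
  exact Submodule.mem_orthogonal_singleton_iff_inner_left.2 (h l hl z hz)

theorem spectralProj_apply_of_notMem {T : E →ₗ.[ℂ] E} (hT : IsSelfAdjoint T) {J : Set ℝ} {l : ℝ}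
    (hl : l ∉ J) {x : E} (hx : x ∈ eigenspace T (l : ℂ)) : spectralProj T J x = 0 :=
  spectralProj_apply_of_forall_inner fun _ hl' _ hy =>
    inner_eq_zero_of_mem_eigenspace hT (fun h => hl (by rwa [← h])) hy hx

/-- To map the range of a spectral projection into a closed subspace, it is enough to do so on the
eigenvectors. -/
theorem apply_spectralProj_mem {T : E →ₗ.[ℂ] E} {J : Set ℝ} {B : E →L[ℂ] E} {K : Submodule ℂ E}
    (hK : IsClosed (K : Set E)) (h : ∀ l ∈ J, ∀ x ∈ eigenspace T (l : ℂ), B x ∈ K) (x : E) :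
    B (spectralProj T J x) ∈ K := by
  have hle : (⨆ l ∈ J, eigenspace T (l : ℂ)).topologicalClosure ≤ K.comap (B : E →ₗ[ℂ] E) :=
    Submodule.topologicalClosure_minimal _ (iSup₂_le fun l hl x hx => h l hl x hx)
      (hK.preimage B.continuous)
  exact hle (Submodule.starProjection_apply_mem _ x)

/-- Each eigenvector is either fixed or killed by the projection on `B`, which therefore preserves
the range of the projection on `A`. This is `key`, an identity `P_A P_B P_A = P_B P_A` whose left
side is symmetric; taking adjoints gives commutation. Completeness of the eigenvectors is not
needed. -/
theorem spectralProj_comm {T : E →ₗ.[ℂ] E} (hT : IsSelfAdjoint T) (A B : Set ℝ) (x : E) :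
    spectralProj T A (spectralProj T B x) = spectralProj T B (spectralProj T A x) := by
  have key : ∀ x, spectralProj T A (spectralProj T B (spectralProj T A x)) =
      spectralProj T B (spectralProj T A x) := fun x => by
    refine Submodule.starProjection_eq_self_iff.2 (apply_spectralProj_mem
      (Submodule.isClosed_topologicalClosure _) (fun l hl y hy => ?_) x)
    by_cases hB : l ∈ B
    · rw [spectralProj_apply_of_mem hB hy]
      exact Submodule.le_topologicalClosure _
        (Submodule.mem_iSup_of_mem l (Submodule.mem_iSup_of_mem hl hy))
    · rw [spectralProj_apply_of_notMem hT hB hy]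
      exact zero_mem _
  refine ext_inner_right ℂ fun y => ?_
  rw [← key x]
  simp only [inner_spectralProj_left]
  rw [key y]

theorem spectralProj_apply_eq_zero_of_disjoint {T : E →ₗ.[ℂ] E} (hT : IsSelfAdjoint T)
    {A B : Set ℝ} (h : Disjoint A B) (x : E) : spectralProj T A (spectralProj T B x) = 0 := by
  rw [← Submodule.mem_bot ℂ]
  refine apply_spectralProj_mem (by simp) (fun l hl y hy => ?_) x
  rw [spectralProj_apply_of_notMem hT (fun hA => h.ne_of_mem hA hl rfl) hy]
  exact zero_mem _

/-- A self-adjoint operator with compact resolvent has pure point spectrum. -/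
theorem exists_mem_eigenspace_of_mem_pmapSpectrum {T : E →ₗ.[ℂ] E} (hT : IsSelfAdjoint T)
    {R : E →L[ℂ] E} (hR : ∀ v, ∃ h : R v ∈ T.domain, T ⟨R v, h⟩ + Complex.I • R v = v)
    (hc : IsCompactOperator R) {l : ℝ} (hl : (l : ℂ) ∈ pmapSpectrum T) :
    ∃ x ∈ eigenspace T (l : ℂ), x ≠ 0 := by
  -- `⟪T x, x⟫` is real, so `T + i` is injective and its right inverse `R` is also a left inverse.
  have hinj : ∀ x : T.domain, T x + Complex.I • (x : E) = 0 → x = 0 := fun x hx => by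
    have h := inner_apply_eq_of_isSelfAdjoint hT x x
    rw [eq_neg_of_add_eq_zero_left hx, inner_neg_left, inner_neg_right, inner_smul_left,
      inner_smul_right, Complex.conj_I] at h
    have h2 : Complex.I * ⟪(x : E), (x : E)⟫_ℂ = 0 := by linear_combination h / 2
    have h3 := (mul_eq_zero.1 h2).resolve_left Complex.I_ne_zero
    exact Subtype.ext (inner_self_eq_zero.1 h3)
  have hsurj : ∀ x : T.domain, R (T x + Complex.I • (x : E)) = x := fun x => by
    obtain ⟨h, hx⟩ := hR (T x + Complex.I • (x : E))
    have := hinj (⟨_, h⟩ - x) (by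
      rw [LinearPMap.map_sub, Submodule.coe_sub, smul_sub]
      rw [← sub_eq_zero] at hx
      rw [← hx]
      abel)
    exact congrArg Subtype.val (sub_eq_zero.1 this)
  set c : ℂ := (l : ℂ) + Complex.I with hcdef
  have hc0 : c ≠ 0 := fun h => by simpa [hcdef] using congrArg Complex.im h
  -- With `c = l + i`, one has `(T - l) R = 1 - c R`. The Fredholm alternative for the compact
  -- operator `R` at `c⁻¹` thus gives either an eigenvector of `T` or bijectivity of `T - l`.
  have hsub : ∀ v, ∀ h : R v ∈ T.domain, T ⟨R v, h⟩ - (l : ℂ) • R v = v - c • R v := fun v h => by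
    obtain ⟨h', hv⟩ := hR v
    rw [hcdef, add_smul]
    nth_rw 3 [← hv]
    abel
  rcases hc.hasEigenvalue_or_mem_resolventSet (inv_ne_zero hc0) with he | hres
  · obtain ⟨v, hv⟩ := he.exists_hasEigenvector
    have hv1 : R v = c⁻¹ • v := hv.apply_eq_smul
    have hv2 : c • R v = v := by rw [hv1, smul_inv_smul₀ hc0]
    obtain ⟨h, -⟩ := hR v
    refine ⟨R v, mem_eigenspace_iff.2 ⟨h, ?_⟩, fun h0 => hv.2 (by rw [← hv2, h0, smul_zero])⟩
    have := hsub v h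
    rwa [hv2, sub_self, sub_eq_zero] at this
  · refine absurd ?_ hl
    have hbij : Function.Bijective fun v => v - c • R v := by
      have h1 : IsUnit (algebraMap ℂ (E →L[ℂ] E) c⁻¹ - R) := spectrum.mem_resolventSet_iff.1 hres
      have h2 : IsUnit (1 - c • R) := by
        have : 1 - c • R = algebraMap ℂ (E →L[ℂ] E) c * (algebraMap ℂ (E →L[ℂ] E) c⁻¹ - R) := by
          rw [mul_sub, ← map_mul, mul_inv_cancel₀ hc0, map_one, Algebra.smul_def]
        rw [this]
        exact ((IsUnit.mk0 c hc0).map _).mul h1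
      exact (ContinuousLinearMap.isUnit_iff_bijective.1 h2)
    constructor
    · intro x y hxy
      have hx := hsub (T x + Complex.I • (x : E)) (by rw [hsurj]; exact x.2)
      have hy := hsub (T y + Complex.I • (y : E)) (by rw [hsurj]; exact y.2)
      simp only [hsurj] at hx hy
      have h := hbij.1 (a₁ := T x + Complex.I • (x : E)) (a₂ := T y + Complex.I • (y : E)) (by
        simp only [hsurj]; rw [← hx, ← hy]; exact hxy)
      refine Subtype.ext ?_
      rw [← hsurj x, h, hsurj]
    · intro y
      obtain ⟨v, hv⟩ := hbij.2 y
      obtain ⟨h, -⟩ := hR v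
      exact ⟨⟨R v, h⟩, (hsub v h).trans hv⟩

end SpectralProjections

end FiberedOp

namespace FiberedOp

/-! ### Calculus of differentials on the base manifold -/

section DiffAt

variable {d : ℕ} {M : Type*} [TopologicalSpace M] [ChartedSpace (EuclideanSpace ℝ (Fin d)) M]
  {G G' G'' : Type*} [NormedAddCommGroup G] [NormedSpace ℝ G] [NormedAddCommGroup G']
  [NormedSpace ℝ G'] [NormedAddCommGroup G''] [NormedSpace ℝ G'']

theorem diffAt_congr {f g : M → G} {k : M} (h : f =ᶠ[𝓝 k] g) :
    diffAt (d := d) f k = diffAt g k := by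
  unfold diffAt
  rw [h.mfderiv_eq]

theorem diffAt_const (c : G) (k : M) : diffAt (d := d) (fun _ : M => c) k = 0 := by
  unfold diffAt
  exact mfderiv_const

theorem diffAt_comp {f : M → G} {φ : G → G'} {φ' : G →L[ℝ] G'} {k : M}
    (hf : MDifferentiableAt 𝓘(ℝ, EuclideanSpace ℝ (Fin d)) 𝓘(ℝ, G) f k)
    (hφ : HasFDerivAt φ φ' (f k)) :
    diffAt (d := d) (fun x => φ (f x)) k = φ' ∘L diffAt f k :=
  (hφ.hasMFDerivAt.comp k hf.hasMFDerivAt).mfderiv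

theorem diffAt_bilin {f : M → G} {g : M → G'} {b : G × G' → G''} {k : M}
    (hb : IsBoundedBilinearMap ℝ b)
    (hf : MDifferentiableAt 𝓘(ℝ, EuclideanSpace ℝ (Fin d)) 𝓘(ℝ, G) f k)
    (hg : MDifferentiableAt 𝓘(ℝ, EuclideanSpace ℝ (Fin d)) 𝓘(ℝ, G') g k)
    (v : TangentSpace 𝓘(ℝ, EuclideanSpace ℝ (Fin d)) k) :
    diffAt (fun x => b (f x, g x)) k v = b (f k, diffAt g k v) + b (diffAt f k v, g k) := by
  have h1 : HasMFDerivAt 𝓘(ℝ, EuclideanSpace ℝ (Fin d)) 𝓘(ℝ, G × G') (fun x => (f x, g x)) k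
      ((diffAt f k).prod (diffAt g k)) :=
    ⟨hf.hasMFDerivAt.1.prodMk hg.hasMFDerivAt.1, hf.hasMFDerivAt.2.prodMk hg.hasMFDerivAt.2⟩
  have h2 : HasMFDerivAt 𝓘(ℝ, G × G') 𝓘(ℝ, G'') b (f k, g k) (hb.deriv (f k, g k)) :=
    (hb.hasFDerivAt (f k, g k)).hasMFDerivAt
  have h3 := (h2.comp k h1).mfderiv
  have h4 := DFunLike.congr_fun h3 v
  exact h4

theorem diffAt_add {f g : M → G} {k : M}
    (hf : MDifferentiableAt 𝓘(ℝ, EuclideanSpace ℝ (Fin d)) 𝓘(ℝ, G) f k)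
    (hg : MDifferentiableAt 𝓘(ℝ, EuclideanSpace ℝ (Fin d)) 𝓘(ℝ, G) g k) :
    diffAt (d := d) (fun x => f x + g x) k = diffAt f k + diffAt g k :=
  (hf.hasMFDerivAt.add hg.hasMFDerivAt).mfderiv

theorem diffAt_smul {f : M → ℝ} {g : M → G} {k : M}
    (hf : MDifferentiableAt 𝓘(ℝ, EuclideanSpace ℝ (Fin d)) 𝓘(ℝ, ℝ) f k)
    (hg : MDifferentiableAt 𝓘(ℝ, EuclideanSpace ℝ (Fin d)) 𝓘(ℝ, G) g k)
    (v : TangentSpace 𝓘(ℝ, EuclideanSpace ℝ (Fin d)) k) :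
    diffAt (fun x => f x • g x) k v = f k • diffAt g k v + diffAt f k v • g k :=
  diffAt_bilin (isBoundedBilinearMap_smul (𝕜 := ℝ) (A := ℝ) (E := G)) hf hg v

variable [IsManifold 𝓘(ℝ, EuclideanSpace ℝ (Fin d)) ω M]

theorem contMDiffOn_diffAt_apply {U : Set M} (hU : IsOpen U) {f : M → G}
    (hf : ContMDiffOn 𝓘(ℝ, EuclideanSpace ℝ (Fin d)) 𝓘(ℝ, G) ∞ f U)
    {X : ∀ k : M, TangentSpace 𝓘(ℝ, EuclideanSpace ℝ (Fin d)) k}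
    (hX : ContMDiffOn 𝓘(ℝ, EuclideanSpace ℝ (Fin d)) (𝓘(ℝ, EuclideanSpace ℝ (Fin d))).tangent ∞
        (fun k => (⟨k, X k⟩ : TangentBundle 𝓘(ℝ, EuclideanSpace ℝ (Fin d)) M)) U) :
    ContMDiffOn 𝓘(ℝ, EuclideanSpace ℝ (Fin d)) 𝓘(ℝ, G) ∞ (fun k => diffAt f k (X k)) U := by
  -- `df(X)` is the fibre component of the tangent map of `f` composed with the section `X`.
  have h1 := hf.contMDiffOn_tangentMapWithin (m := ∞) le_rfl hU.uniqueMDiffOn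
  have h2 := h1.comp hX (fun k hk => hk)
  have h3 := (contMDiff_snd_tangentBundle_modelSpace (n := ∞) G 𝓘(ℝ, G)).comp_contMDiffOn h2
  refine h3.congr fun k hk => ?_
  change mfderiv _ _ f k (X k) = mfderivWithin _ _ f U k (X k)
  rw [mfderivWithin_of_isOpen hU hk]

end DiffAt

/-! ### Real smoothness of complex-linear operations -/

section ComplexSmooth

variable {d : ℕ} {M : Type*} [TopologicalSpace M] [ChartedSpace (EuclideanSpace ℝ (Fin d)) M]
  {G G' : Type*} [NormedAddCommGroup G] [InnerProductSpace ℂ G] [NormedAddCommGroup G']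
  [InnerProductSpace ℂ G'] {U : Set M} {n : ℕ∞ω}

theorem contMDiffOn_clm_apply_complex {A : M → G →L[ℂ] G'} {c : M → G}
    (hA : ContMDiffOn 𝓘(ℝ, EuclideanSpace ℝ (Fin d)) 𝓘(ℝ, G →L[ℂ] G') n A U)
    (hc : ContMDiffOn 𝓘(ℝ, EuclideanSpace ℝ (Fin d)) 𝓘(ℝ, G) n c U) :
    ContMDiffOn 𝓘(ℝ, EuclideanSpace ℝ (Fin d)) 𝓘(ℝ, G') n (fun k => A k (c k)) U := by
  have h := (ContinuousLinearMap.restrictScalarsL ℂ G G' ℝ ℝ).contDiff (n := n)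
  exact (h.contMDiff.comp_contMDiffOn hA).clm_apply hc

theorem contMDiffOn_inner_complex {a b : M → G}
    (ha : ContMDiffOn 𝓘(ℝ, EuclideanSpace ℝ (Fin d)) 𝓘(ℝ, G) n a U)
    (hb : ContMDiffOn 𝓘(ℝ, EuclideanSpace ℝ (Fin d)) 𝓘(ℝ, G) n b U) :
    ContMDiffOn 𝓘(ℝ, EuclideanSpace ℝ (Fin d)) 𝓘(ℝ, ℂ) n (fun k => ⟪a k, b k⟫_ℂ) U :=
  (contDiff_inner (𝕜 := ℂ) (E := G) (n := n)).contMDiff.comp_contMDiffOn (ha.prodMk_space hb)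

end ComplexSmooth

/-! ### Smooth sections of the Hilbert bundle -/

section Sections

variable {d : ℕ} {M : Type*} [TopologicalSpace M] [ChartedSpace (EuclideanSpace ℝ (Fin d)) M]
  {F : M → Type*} [∀ k, NormedAddCommGroup (F k)] [∀ k, InnerProductSpace ℂ (F k)]
  {H' : Type*} [NormedAddCommGroup H'] [InnerProductSpace ℂ H']
  {𝓑 : HilbertBundle d F H'} {U U' : Set M} {s t : ∀ k, F k}

namespace HilbertBundle

theorem SmoothOn.mono (hs : 𝓑.SmoothOn U s) (h : U' ⊆ U) : 𝓑.SmoothOn U' s :=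
  fun i => (hs i).mono (inter_subset_inter_left _ h)

theorem SmoothOn.congr (hs : 𝓑.SmoothOn U s) (h : ∀ k ∈ U, t k = s k) : 𝓑.SmoothOn U t :=
  fun i => (hs i).congr fun k hk => by rw [h k hk.1]

theorem SmoothOn.add (hs : 𝓑.SmoothOn U s) (ht : 𝓑.SmoothOn U t) :
    𝓑.SmoothOn U (fun k => s k + t k) :=
  fun i => ((hs i).add (ht i)).congr fun k _ => by simp

theorem SmoothOn.smul {f : M → ℝ}
    (hf : ContMDiffOn 𝓘(ℝ, EuclideanSpace ℝ (Fin d)) 𝓘(ℝ, ℝ) ∞ f U) (hs : 𝓑.SmoothOn U s) :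
    𝓑.SmoothOn U (fun k => f k • s k) :=
  fun i => ((hf.mono inter_subset_left).smul (hs i)).congr fun k _ => by
    simpa using map_smul (𝓑.triv i k) (f k : ℂ) (s k)

theorem SmoothOn.sub (hs : 𝓑.SmoothOn U s) (ht : 𝓑.SmoothOn U t) :
    𝓑.SmoothOn U (fun k => s k - t k) :=
  fun i => ((hs i).sub (ht i)).congr fun k _ => by simp

theorem SmoothOn.zero : 𝓑.SmoothOn U (fun _ => 0) :=
  fun i => by simpa using contMDiffOn_const

theorem SmoothOn.union (hU : IsOpen U) (hU' : IsOpen U') (hs : 𝓑.SmoothOn U s)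
    (hs' : 𝓑.SmoothOn U' s) : 𝓑.SmoothOn (U ∪ U') s := fun i => by
  rw [union_inter_distrib_right]
  exact (hs i).union_of_isOpen (hs' i) (hU.inter (𝓑.isOpen_base i)) (hU'.inter (𝓑.isOpen_base i))

theorem SmoothOn.contMDiffOn_inner (hU : IsOpen U) (hs : 𝓑.SmoothOn U s) (ht : 𝓑.SmoothOn U t) :
    ContMDiffOn 𝓘(ℝ, EuclideanSpace ℝ (Fin d)) 𝓘(ℝ, ℂ) ∞ (fun k => ⟪s k, t k⟫_ℂ) U := by
  intro k hk
  obtain ⟨i, hi⟩ := 𝓑.cover k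
  have h := contMDiffOn_inner_complex (hs i) (ht i)
  simp only [LinearIsometryEquiv.inner_map_map] at h
  exact (h.contMDiffAt ((hU.inter (𝓑.isOpen_base i)).mem_nhds ⟨hk, hi⟩)).contMDiffWithinAt

variable {μ : ℕ} {W : ∀ k, EuclideanSpace ℂ (Fin μ) →L[ℂ] F k}

theorem FrameAnalyticOn.smoothOn_apply (hW : 𝓑.FrameAnalyticOn U W)
    {c : M → EuclideanSpace ℂ (Fin μ)}
    (hc : ContMDiffOn 𝓘(ℝ, EuclideanSpace ℝ (Fin d)) 𝓘(ℝ, EuclideanSpace ℂ (Fin μ)) ∞ c U) :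
    𝓑.SmoothOn U (fun k => W k (c k)) :=
  fun i => contMDiffOn_clm_apply_complex ((hW i).of_le le_top) (hc.mono inter_subset_left)

/-- The coordinates of `W^* s` in an orthonormal basis are `⟪W e_i, s⟫`, so smoothness follows from
that of inner products, without differentiating `k ↦ (W k)^*`. -/
theorem FrameAnalyticOn.contMDiffOn_adjoint_apply [∀ k, CompleteSpace (F k)] (hU : IsOpen U)
    (hW : 𝓑.FrameAnalyticOn U W) (hs : 𝓑.SmoothOn U s) :
    ContMDiffOn 𝓘(ℝ, EuclideanSpace ℝ (Fin d)) 𝓘(ℝ, EuclideanSpace ℂ (Fin μ)) ∞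
      (fun k => ContinuousLinearMap.adjoint (W k) (s k)) U := by
  set e := EuclideanSpace.basisFun (Fin μ) ℂ
  have h : ∀ k, ContinuousLinearMap.adjoint (W k) (s k) = ∑ i, ⟪W k (e i), s k⟫_ℂ • e i :=
    fun k => by
      rw [← e.sum_repr' (ContinuousLinearMap.adjoint (W k) (s k))]
      simp only [ContinuousLinearMap.adjoint_inner_right]
  simp only [h]
  refine contMDiffOn_finsetSum fun i _ => ?_
  have h1 := SmoothOn.contMDiffOn_inner hU (hW.smoothOn_apply (contMDiffOn_const (c := e i))) hs
  exact (((ContinuousLinearMap.id ℝ ℂ).smulRight (e i)).contDiff.contMDiff).comp_contMDiffOn h1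

theorem SubSection.mono {π : ∀ k, F k →L[ℂ] F k} (hs : 𝓑.SubSection π U s) (h : U' ⊆ U) :
    𝓑.SubSection π U' s :=
  ⟨hs.1.mono h, fun k hk => hs.2 k (h hk)⟩

theorem SubSection.sub {π : ∀ k, F k →L[ℂ] F k} (hs : 𝓑.SubSection π U s)
    (ht : 𝓑.SubSection π U t) : 𝓑.SubSection π U (fun k => s k - t k) :=
  ⟨hs.1.sub ht.1, fun k hk => sub_mem (hs.2 k hk) (ht.2 k hk)⟩

theorem SubSection.zero {π : ∀ k, F k →L[ℂ] F k} : 𝓑.SubSection π U (fun _ => 0) :=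
  ⟨.zero, fun _ _ => zero_mem _⟩

end HilbertBundle

end Sections

end FiberedOp

namespace FiberedOp

/-! ### Real scalars and isometries in complex Hilbert spaces -/

section ComplexHilbert

variable {E : Type*} [NormedAddCommGroup E] [InnerProductSpace ℂ E]

theorem inner_real_smul_left (r : ℝ) (x y : E) : ⟪r • x, y⟫_ℂ = (r : ℂ) * ⟪x, y⟫_ℂ := by
  rw [← Complex.coe_smul, inner_smul_left, Complex.conj_ofReal]

theorem inner_real_smul_right (r : ℝ) (x y : E) : ⟪x, r • y⟫_ℂ = (r : ℂ) * ⟪x, y⟫_ℂ := by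
  rw [← Complex.coe_smul, inner_smul_right]

theorem apply_adjoint_of_mem_range {E' : Type*} [NormedAddCommGroup E'] [InnerProductSpace ℂ E']
    [CompleteSpace E] [CompleteSpace E'] {A : E' →L[ℂ] E} (h : ∀ c, ‖A c‖ = ‖c‖) {x : E}
    (hx : x ∈ LinearMap.range (A : E' →ₗ[ℂ] E)) : A (ContinuousLinearMap.adjoint A x) = x := by
  obtain ⟨c, rfl⟩ := hx
  exact congrArg A
    (DFunLike.congr_fun ((ContinuousLinearMap.norm_map_iff_adjoint_comp_self A).1 h) c)

end ComplexHilbert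

variable {d : ℕ} {M : Type*} [TopologicalSpace M] [ChartedSpace (EuclideanSpace ℝ (Fin d)) M]
  {F : M → Type*} [∀ k, NormedAddCommGroup (F k)] [∀ k, InnerProductSpace ℂ (F k)]
  {H' : Type*} [NormedAddCommGroup H'] [InnerProductSpace ℂ H']
  {𝓑 : HilbertBundle d F H'} {O U : Set M} {π : ∀ k, F k →L[ℂ] F k} {V : M → ℝ}

/-! ### The connection induced by a frame -/

section FrameConnection

variable [∀ k, CompleteSpace (F k)] {μ : ℕ} {W : ∀ k, EuclideanSpace ℂ (Fin μ) →L[ℂ] F k}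

theorem frameCov_apply (s : ∀ k, F k) (k : M)
    (v : TangentSpace 𝓘(ℝ, EuclideanSpace ℝ (Fin d)) k) :
    frameCov W V s k v =
      W k (diffAt (fun k => ContinuousLinearMap.adjoint (W k) (s k)) k v) +
        diffAt V k v • s k := rfl

theorem frameCov_mem_range
    (hrange : ∀ k ∈ O, LinearMap.range (W k : EuclideanSpace ℂ (Fin μ) →ₗ[ℂ] F k) =
      LinearMap.range (π k : F k →ₗ[ℂ] F k)) (hU : U ⊆ O) {s : ∀ k, F k}
    (hs : 𝓑.SubSection π U s) {k : M} (hk : k ∈ U)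
    (v : TangentSpace 𝓘(ℝ, EuclideanSpace ℝ (Fin d)) k) :
    frameCov W V s k v ∈ LinearMap.range (π k : F k →ₗ[ℂ] F k) := by
  rw [frameCov_apply]
  refine add_mem ?_ ?_
  · rw [← hrange k (hU hk)]
    exact ⟨_, rfl⟩
  · exact Submodule.smul_of_tower_mem _ _ (hs.2 k hk)

theorem mdifferentiableAt_of_contMDiffOn {G : Type*} [NormedAddCommGroup G] [NormedSpace ℝ G]
    {f : M → G} (hU : IsOpen U)
    (hf : ContMDiffOn 𝓘(ℝ, EuclideanSpace ℝ (Fin d)) 𝓘(ℝ, G) ∞ f U) {k : M} (hk : k ∈ U) :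
    MDifferentiableAt 𝓘(ℝ, EuclideanSpace ℝ (Fin d)) 𝓘(ℝ, G) f k :=
  (hf.contMDiffAt (hU.mem_nhds hk)).mdifferentiableAt (by simp)

/-- The frame connection is compatible with the metric `⟨·,·⟩ e^{2V}`. -/
theorem frameCov_unitary (hW : 𝓑.FrameAnalyticOn O W) (hiso : ∀ k ∈ O, ∀ c, ‖W k c‖ = ‖c‖)
    (hrange : ∀ k ∈ O, LinearMap.range (W k : EuclideanSpace ℂ (Fin μ) →ₗ[ℂ] F k) =
      LinearMap.range (π k : F k →ₗ[ℂ] F k))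
    (hV : ContMDiffOn 𝓘(ℝ, EuclideanSpace ℝ (Fin d)) 𝓘(ℝ, ℝ) ∞ V O)
    (hUO : U ⊆ O) (hU : IsOpen U) {s t : ∀ k, F k} (hs : 𝓑.SubSection π U s)
    (ht : 𝓑.SubSection π U t) {k : M} (hk : k ∈ U)
    (v : TangentSpace 𝓘(ℝ, EuclideanSpace ℝ (Fin d)) k) :
    diffAt (fun k => ⟪s k, t k⟫_ℂ * (Real.exp (2 * V k) : ℂ)) k v =
      (⟪frameCov W V s k v, t k⟫_ℂ + ⟪s k, frameCov W V t k v⟫_ℂ) *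
        (Real.exp (2 * V k) : ℂ) := by
  have hWU : 𝓑.FrameAnalyticOn U W := fun i => (hW i).mono (inter_subset_inter_left _ hUO)
  have ha := hWU.contMDiffOn_adjoint_apply hU hs.1
  have hb := hWU.contMDiffOn_adjoint_apply hU ht.1
  set a := fun k => ContinuousLinearMap.adjoint (W k) (s k) with ha_def
  set b := fun k => ContinuousLinearMap.adjoint (W k) (t k) with hb_def
  have hsa : ∀ k ∈ U, W k (a k) = s k := fun k hk =>
    apply_adjoint_of_mem_range (hiso k (hUO hk)) (by rw [hrange k (hUO hk)]; exact hs.2 k hk)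
  -- In frame coordinates the metric is the constant one times `e^{2V}`. The derivative `2 dV
  -- e^{2V}` of the weight is shared equally between the two terms `dV(X)` of the connection.
  have hst : ∀ k ∈ U, ⟪s k, t k⟫_ℂ = ⟪a k, b k⟫_ℂ := fun k hk => by
    rw [← hsa k hk, hb_def, ContinuousLinearMap.adjoint_inner_right]
  have hda := mdifferentiableAt_of_contMDiffOn hU ha hk
  have hdb := mdifferentiableAt_of_contMDiffOn hU hb hk
  have hdab := mdifferentiableAt_of_contMDiffOn hU (contMDiffOn_inner_complex ha hb) hk
  have hdV := mdifferentiableAt_of_contMDiffOn hU (hV.mono hUO) hk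
  have hexp : HasFDerivAt (fun x : ℝ => (Real.exp (2 * x) : ℂ))
      ((ContinuousLinearMap.id ℝ ℝ).smulRight ((2 * Real.exp (2 * V k) : ℝ) : ℂ)) (V k) := by
    have h := (((hasDerivAt_id (V k)).const_mul (2 : ℝ)).exp.ofReal_comp).hasFDerivAt
    refine h.congr_fderiv (ContinuousLinearMap.ext_ring ?_)
    simp [mul_comm]
  have hφ : MDifferentiableAt 𝓘(ℝ, EuclideanSpace ℝ (Fin d)) 𝓘(ℝ, ℂ)
      (fun k => (Real.exp (2 * V k) : ℂ)) k :=
    (hexp.hasMFDerivAt.comp k hdV.hasMFDerivAt).mdifferentiableAt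
  have hev : (fun k => ⟪s k, t k⟫_ℂ * (Real.exp (2 * V k) : ℂ)) =ᶠ[𝓝 k]
      fun k => ⟪a k, b k⟫_ℂ * (Real.exp (2 * V k) : ℂ) := by
    filter_upwards [hU.mem_nhds hk] with x hx
    rw [hst x hx]
  have h1 := diffAt_bilin (isBoundedBilinearMap_smul (𝕜 := ℝ) (A := ℂ) (E := ℂ)) hdab hφ v
  have h2 := diffAt_bilin (isBoundedBilinearMap_inner (𝕜 := ℂ) (E := EuclideanSpace ℂ (Fin μ)))
    hda hdb v
  have h3 : diffAt (fun k => (Real.exp (2 * V k) : ℂ)) k v =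
      diffAt V k v • ((2 * Real.exp (2 * V k) : ℝ) : ℂ) :=
    DFunLike.congr_fun (diffAt_comp hdV hexp) v
  simp only [smul_eq_mul] at h1
  have hDs : ⟪frameCov W V s k v, t k⟫_ℂ =
      ⟪diffAt a k v, b k⟫_ℂ + ((diffAt V k v : ℝ) : ℂ) * ⟪a k, b k⟫_ℂ := by
    rw [frameCov_apply, inner_add_left, ← ContinuousLinearMap.adjoint_inner_right,
      inner_real_smul_left, hst k hk]
  have hDt : ⟪s k, frameCov W V t k v⟫_ℂ =
      ⟪a k, diffAt b k v⟫_ℂ + ((diffAt V k v : ℝ) : ℂ) * ⟪a k, b k⟫_ℂ := by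
    rw [frameCov_apply, inner_add_right, ← ContinuousLinearMap.adjoint_inner_left,
      inner_real_smul_right, hst k hk]
  rw [diffAt_congr hev, h1, h2, h3, hDs, hDt, Complex.real_smul]
  push_cast
  ring

variable [IsManifold 𝓘(ℝ, EuclideanSpace ℝ (Fin d)) ω M]

theorem isUnitaryConnection_frameCov (hW : 𝓑.FrameAnalyticOn O W)
    (hiso : ∀ k ∈ O, ∀ c, ‖W k c‖ = ‖c‖)
    (hrange : ∀ k ∈ O, LinearMap.range (W k : EuclideanSpace ℂ (Fin μ) →ₗ[ℂ] F k) =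
      LinearMap.range (π k : F k →ₗ[ℂ] F k))
    (hV : ContMDiffOn 𝓘(ℝ, EuclideanSpace ℝ (Fin d)) 𝓘(ℝ, ℝ) ∞ V O) :
    IsUnitaryConnection 𝓑 O π V (frameCov W V) where
  maps U hUO hU s hs X hX := by
    have hWU : 𝓑.FrameAnalyticOn U W := fun i => (hW i).mono (inter_subset_inter_left _ hUO)
    refine ⟨?_, fun k hk => frameCov_mem_range hrange hUO hs hk _⟩
    refine HilbertBundle.SmoothOn.add (hWU.smoothOn_apply
      (contMDiffOn_diffAt_apply hU (hWU.contMDiffOn_adjoint_apply hU hs.1) hX)) ?_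
    exact HilbertBundle.SmoothOn.smul (contMDiffOn_diffAt_apply hU (hV.mono hUO) hX) hs.1
  add U hUO hU s t hs ht k hk := by
    have hWU : 𝓑.FrameAnalyticOn U W := fun i => (hW i).mono (inter_subset_inter_left _ hUO)
    have ha := mdifferentiableAt_of_contMDiffOn hU (hWU.contMDiffOn_adjoint_apply hU hs.1) hk
    have hb := mdifferentiableAt_of_contMDiffOn hU (hWU.contMDiffOn_adjoint_apply hU ht.1) hk
    ext v
    rw [add_apply]
    simp only [frameCov_apply, map_add]
    rw [diffAt_add ha hb, add_apply, map_add, smul_add]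
    abel
  smul U hUO hU c s hs k hk v := by
    have hWU : 𝓑.FrameAnalyticOn U W := fun i => (hW i).mono (inter_subset_inter_left _ hUO)
    have ha := mdifferentiableAt_of_contMDiffOn hU (hWU.contMDiffOn_adjoint_apply hU hs.1) hk
    have h := DFunLike.congr_fun (diffAt_comp (φ := fun x => c • x) ha
      (c • ContinuousLinearMap.id ℝ (EuclideanSpace ℂ (Fin μ))).hasFDerivAt) v
    simp only [frameCov_apply, map_smul]
    rw [h, smul_add, smul_comm c (diffAt V k v)]
    exact congrArg (· + _) (map_smul (W k) c _)
  leibniz U hUO hU f s hf hs k hk v := by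
    have hWU : 𝓑.FrameAnalyticOn U W := fun i => (hW i).mono (inter_subset_inter_left _ hUO)
    have ha := mdifferentiableAt_of_contMDiffOn hU (hWU.contMDiffOn_adjoint_apply hU hs.1) hk
    have hsa := apply_adjoint_of_mem_range (hiso k (hUO hk))
      (by rw [hrange k (hUO hk)]; exact hs.2 k hk)
    simp only [frameCov_apply, ContinuousLinearMap.map_smul_of_tower]
    rw [diffAt_smul (mdifferentiableAt_of_contMDiffOn hU hf hk) ha, map_add, ContinuousLinearMap.map_smul_of_tower,
      ContinuousLinearMap.map_smul_of_tower, hsa, smul_add, smul_comm (f k) (diffAt V k v)]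
    abel
  unitary U hUO hU s t hs ht k hk v := frameCov_unitary hW hiso hrange hV hUO hU hs ht hk v

end FrameConnection

end FiberedOp

namespace FiberedOp

/-! ### Splitting a connection along a projection -/

variable {d : ℕ} {M : Type*} [TopologicalSpace M] [ChartedSpace (EuclideanSpace ℝ (Fin d)) M]
  {F : M → Type*} [∀ k, NormedAddCommGroup (F k)] [∀ k, InnerProductSpace ℂ (F k)]

/-- To be read with `a = D(Q s)`, `b = D(s - Q s)`, and `a'`, `b'` likewise for `t`. Splitting
removes `r ((1 - Q) a + Q b)`; the contributions of the removed terms add up to `r` times the sum of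
`h` and `h'`, which are the derivatives of `⟪Q s, (1 - Q) t⟫ = 0` and `⟪(1 - Q) s, Q t⟫ = 0`. -/
theorem inner_split_add_inner_split {E : Type*} [NormedAddCommGroup E] [InnerProductSpace ℂ E]
    {Q : E →L[ℂ] E} (hQ : ∀ x y, ⟪Q x, y⟫_ℂ = ⟪x, Q y⟫_ℂ) {x y a b a' b' : E} {r : ℝ}
    (h : ⟪a, y - Q y⟫_ℂ + ⟪Q x, b'⟫_ℂ = 0) (h' : ⟪b, Q y⟫_ℂ + ⟪x - Q x, a'⟫_ℂ = 0) :
    ⟪(1 - r) • (a + b) + r • (Q a + (b - Q b)), y⟫_ℂ +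
      ⟪x, (1 - r) • (a' + b') + r • (Q a' + (b' - Q b'))⟫_ℂ = ⟪a + b, y⟫_ℂ + ⟪x, a' + b'⟫_ℂ := by
  simp only [inner_add_left, inner_add_right, inner_real_smul_left, inner_real_smul_right,
    inner_sub_left, inner_sub_right] at h h' ⊢
  rw [hQ a y, hQ b y, ← hQ x a', ← hQ x b']
  push_cast
  linear_combination (-(r : ℂ)) * (h + h')

/-- The connection `(1 - θ) D + θ (Q D Q + (1 - Q) D (1 - Q))`. -/
noncomputable def splitCov (θ : M → ℝ) (Q : ∀ k, F k →L[ℂ] F k) (D : Cov d F) : Cov d F := fun s k =>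
  (1 - θ k) • D s k + θ k •
    (((Q k).restrictScalars ℝ) ∘L D (fun k => Q k (s k)) k +
      ((ContinuousLinearMap.id ℂ (F k) - Q k).restrictScalars ℝ) ∘L
        D (fun k => s k - Q k (s k)) k)

section

variable {θ : M → ℝ} {Q P : ∀ k, F k →L[ℂ] F k} {D : Cov d F} {k : M}

theorem splitCov_apply (s : ∀ k, F k) (v : TangentSpace 𝓘(ℝ, EuclideanSpace ℝ (Fin d)) k) :
    splitCov θ Q D s k v = (1 - θ k) • D s k v + θ k • (Q k (D (fun k => Q k (s k)) k v) +
      (D (fun k => s k - Q k (s k)) k v - Q k (D (fun k => s k - Q k (s k)) k v))) := rfl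

theorem splitCov_of_eq_zero (h : θ k = 0) (s : ∀ k, F k) :
    splitCov θ Q D s k = D s k := by
  ext v
  simp [splitCov_apply, h]

end

variable {H' : Type*} [NormedAddCommGroup H'] [InnerProductSpace ℂ H'] {𝓑 : HilbertBundle d F H'}
  {O O' O'' U : Set M} {π Q R P : ∀ k, F k →L[ℂ] F k} {V θ : M → ℝ} {D : Cov d F} {s t : ∀ k, F k}
  {k : M}

/-- `Q` is a family of orthogonal projections, smooth over `O`. -/
structure IsSmoothProj (𝓑 : HilbertBundle d F H') (O : Set M) (Q : ∀ k, F k →L[ℂ] F k) :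
    Prop where
  idem : ∀ k x, Q k (Q k x) = Q k x
  symm : ∀ k x y, ⟪Q k x, y⟫_ℂ = ⟪x, Q k y⟫_ℂ
  smooth : ∀ U ⊆ O, IsOpen U → ∀ s, 𝓑.SmoothOn U s → 𝓑.SmoothOn U (fun k => Q k (s k))

/-- The covariant derivatives of sections of `π F` take their values in `π F`. -/
def PreservesFibers (𝓑 : HilbertBundle d F H') (O : Set M) (π : ∀ k, F k →L[ℂ] F k)
    (D : Cov d F) : Prop :=
  ∀ U ⊆ O, IsOpen U → ∀ s, 𝓑.SubSection π U s → ∀ k ∈ U, ∀ v,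
    D s k v ∈ LinearMap.range (π k : F k →ₗ[ℂ] F k)

/-- The endomorphism `R` of `π F → O` is parallel at `k` for `D`. -/
def ParallelAt (𝓑 : HilbertBundle d F H') (O : Set M) (π : ∀ k, F k →L[ℂ] F k)
    (D : Cov d F) (R : ∀ k, F k →L[ℂ] F k) (k : M) : Prop :=
  ∀ U ⊆ O, IsOpen U → k ∈ U → ∀ s, 𝓑.SubSection π U s → ∀ v,
    D (fun k => R k (s k)) k v = R k (D s k v)

theorem HilbertBundle.SubSection.proj (hQ : IsSmoothProj 𝓑 O' Q)
    (hcomm : ∀ k x, Q k (π k x) = π k (Q k x)) (hUO : U ⊆ O') (hU : IsOpen U)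
    (hs : 𝓑.SubSection π U s) : 𝓑.SubSection π U (fun k => Q k (s k)) := by
  refine ⟨hQ.smooth U hUO hU s hs.1, fun k hk => ?_⟩
  obtain ⟨x, hx⟩ := hs.2 k hk
  exact ⟨Q k x, (hcomm k x).symm.trans (congrArg (Q k) hx)⟩

theorem PreservesFibers.splitCov (hD : PreservesFibers 𝓑 O π D) (hQ : IsSmoothProj 𝓑 O' Q)
    (hO' : IsOpen O') (hθ : tsupport θ ⊆ O') (hcomm : ∀ k x, Q k (π k x) = π k (Q k x)) :
    PreservesFibers 𝓑 O π (splitCov θ Q D) := by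
  intro U hUO hU s hs k hk v
  -- `Q` is known to be smooth only over `O'`; elsewhere `θ = 0` and the split connection is `D`.
  by_cases hkO : k ∈ O'
  · have hs' := hs.mono (inter_subset_left (t := O'))
    have hQs := hs'.proj hQ hcomm inter_subset_right (hU.inter hO')
    have hmem : ∀ t, 𝓑.SubSection π (U ∩ O') t → D t k v ∈ LinearMap.range (π k : F k →ₗ[ℂ] F k) :=
      fun t ht => hD _ (inter_subset_left.trans hUO) (hU.inter hO') t ht k ⟨hk, hkO⟩ v
    have hQmem : ∀ x ∈ LinearMap.range (π k : F k →ₗ[ℂ] F k),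
        Q k x ∈ LinearMap.range (π k : F k →ₗ[ℂ] F k) := by
      rintro _ ⟨x, rfl⟩
      exact ⟨Q k x, (hcomm k x).symm⟩
    have h1 := hmem _ hQs
    have h2 := hmem _ (hs'.sub hQs)
    rw [splitCov_apply]
    exact add_mem (Submodule.smul_of_tower_mem _ _ (hmem _ hs')) (Submodule.smul_of_tower_mem _ _
      (add_mem (hQmem _ h1) (sub_mem h2 (hQmem _ h2))))
  · rw [splitCov_of_eq_zero (image_eq_zero_of_notMem_tsupport fun h => hkO (hθ h))]
    exact hD U hUO hU s hs k hk v

/-- Splitting along `Q` preserves the parallel endomorphisms which commute with `Q`. -/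
theorem ParallelAt.splitCov (hR : ParallelAt 𝓑 O π D R k) (hQ : IsSmoothProj 𝓑 O' Q)
    (hO' : IsOpen O') (hθ : tsupport θ ⊆ O') (hcomm : ∀ k x, Q k (π k x) = π k (Q k x))
    (hQR : ∀ k x, Q k (R k x) = R k (Q k x)) : ParallelAt 𝓑 O π (splitCov θ Q D) R k := by
  intro U hU hUo hk s hs v
  by_cases hkO : k ∈ O'
  · have hs' := hs.mono (inter_subset_left (t := O'))
    have hQs := hs'.proj hQ hcomm inter_subset_right (hUo.inter hO')
    have h := fun t ht => hR (U ∩ O') (inter_subset_left.trans hU) (hUo.inter hO') ⟨hk, hkO⟩ t ht v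
    simp only [splitCov_apply, hQR, ← map_sub, h _ hs', h _ hQs, h _ (hs'.sub hQs)]
    simp only [map_add, ContinuousLinearMap.map_smul_of_tower, map_sub]
  · rw [splitCov_of_eq_zero (image_eq_zero_of_notMem_tsupport fun h => hkO (hθ h)),
      splitCov_of_eq_zero (image_eq_zero_of_notMem_tsupport fun h => hkO (hθ h))]
    exact hR U hU hUo hk s hs v

variable [IsManifold 𝓘(ℝ, EuclideanSpace ℝ (Fin d)) 1 M]

namespace IsUnitaryConnection

theorem apply_zero (hD : IsUnitaryConnection 𝓑 O π V D) (hUO : U ⊆ O) (hU : IsOpen U)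
    (hk : k ∈ U) : D (fun _ => 0) k = 0 := by
  ext v
  simpa using hD.smul U hUO hU 0 (fun _ => 0) .zero k hk v

/-- Covariant derivatives are local. -/
theorem congr (hD : IsUnitaryConnection 𝓑 O π V D) (hUO : U ⊆ O) (hU : IsOpen U)
    (ht : 𝓑.SubSection π U t) (h : ∀ k ∈ U, s k = t k) (hk : k ∈ U) :
    D s k = D t k := by
  classical
  have hw : 𝓑.SubSection π U (fun k => s k - t k) :=
    ⟨HilbertBundle.SmoothOn.zero.congr fun k hk => by rw [h k hk, sub_self],
      fun k hk => by simp only [h k hk, sub_self, zero_mem]⟩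
  -- The indicator `f` of `Uᶜ` vanishes on `U`, yet `f (s - t) = s - t` everywhere since `s = t` on
  -- `U`. The Leibniz rule then forces `D (s - t) = 0` on `U`.
  have hf0 : ∀ k ∈ U, (Uᶜ.indicator (fun _ => (1 : ℝ))) k = 0 := fun k hk => by simp [hk]
  have hf : ContMDiffOn 𝓘(ℝ, EuclideanSpace ℝ (Fin d)) 𝓘(ℝ, ℝ) ∞
      (Uᶜ.indicator (fun _ => (1 : ℝ))) U := contMDiffOn_const.congr hf0
  have hfw : (fun k => (Uᶜ.indicator (fun _ => (1 : ℝ))) k • (s k - t k)) =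
      fun k => s k - t k := by
    funext k
    by_cases hk : k ∈ U
    · simp [h k hk]
    · simp [hk]
  have h0 : D (fun k => s k - t k) k = 0 := by
    ext v
    have := hD.leibniz U hUO hU _ _ hf hw k hk v
    rwa [hfw, hf0 k hk, h k hk, sub_self, smul_zero, zero_smul, add_zero] at this
  have h1 := hD.add U hUO hU _ _ hw ht k hk
  simpa only [sub_add_cancel, h0, zero_add] using h1

end IsUnitaryConnection

theorem IsUnitaryConnection.splitCov (hD : IsUnitaryConnection 𝓑 O π V D)
    (hF : PreservesFibers 𝓑 O π D) (hQ : IsSmoothProj 𝓑 O' Q)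
    (hO' : IsOpen O') (hθ : tsupport θ ⊆ O')
    (hθs : ContMDiff 𝓘(ℝ, EuclideanSpace ℝ (Fin d)) 𝓘(ℝ, ℝ) ∞ θ)
    (hcomm : ∀ k x, Q k (π k x) = π k (Q k x)) :
    IsUnitaryConnection 𝓑 O π V (splitCov θ Q D) := by
  have hzero : ∀ k, k ∉ O' → θ k = 0 := fun k hk =>
    image_eq_zero_of_notMem_tsupport fun h => hk (hθ h)
  have hsub : ∀ U ⊆ O, U ∩ O' ⊆ O := fun U hUO => inter_subset_left.trans hUO
  have hproj : ∀ U : Set M, IsOpen U → ∀ s, 𝓑.SubSection π U s →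
      𝓑.SubSection π (U ∩ O') s ∧ 𝓑.SubSection π (U ∩ O') (fun k => Q k (s k)) ∧
      𝓑.SubSection π (U ∩ O') (fun k => s k - Q k (s k)) := fun U hU s hs =>
    have hs' := hs.mono (inter_subset_left (t := O'))
    have hQs := hs'.proj hQ hcomm inter_subset_right (hU.inter hO')
    ⟨hs', hQs, hs'.sub hQs⟩
  refine ⟨?_, ?_, ?_, ?_, ?_⟩
  · intro U hUO hU s hs X hX
    refine ⟨?_, fun k hk => hF.splitCov hQ hO' hθ hcomm U hUO hU s hs k hk (X k)⟩
    -- Smoothness is glued from two open sets: on the first `Q` is smooth, on the second the split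
    -- connection is `D`.
    have hcover : U = U ∩ O' ∪ U \ tsupport θ := by
      rw [sdiff_eq, ← inter_union_distrib_left, eq_comm, inter_eq_left]
      exact fun k _ => or_iff_not_imp_left.2 fun hk h => hk (hθ h)
    have hopen : IsOpen (U \ tsupport θ) := hU.sdiff (isClosed_tsupport θ)
    rw [hcover]
    refine HilbertBundle.SmoothOn.union (hU.inter hO') hopen ?_ ?_
    · obtain ⟨h1, h2, h3⟩ := hproj U hU s hs
      have hm : ∀ t, 𝓑.SubSection π (U ∩ O') t → 𝓑.SmoothOn (U ∩ O') fun k => D t k (X k) :=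
        fun t ht => (hD.maps _ (hsub U hUO) (hU.inter hO') t ht X
          (hX.mono inter_subset_left)).1
      have hQm : ∀ t, 𝓑.SmoothOn (U ∩ O') t → 𝓑.SmoothOn (U ∩ O') fun k => Q k (t k) :=
        hQ.smooth _ inter_subset_right (hU.inter hO')
      have hθ' := hθs.contMDiffOn (s := U ∩ O')
      simp only [splitCov_apply]
      refine (HilbertBundle.SmoothOn.smul (contMDiffOn_const.sub hθ') (hm _ h1)).add
        (HilbertBundle.SmoothOn.smul hθ' ((hQm _ (hm _ h2)).add
          ((hm _ h3).sub (hQm _ (hm _ h3)))))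
    · refine ((hD.maps U hUO hU s hs X hX).1.mono sdiff_subset).congr fun k hk => ?_
      rw [splitCov_of_eq_zero (image_eq_zero_of_notMem_tsupport hk.2)]
  · intro U hUO hU s t hs ht k hk
    by_cases hkO : k ∈ O'
    · obtain ⟨h1, h2, h3⟩ := hproj U hU s hs
      obtain ⟨h1', h2', h3'⟩ := hproj U hU t ht
      have hadd := fun s t hs ht => hD.add _ (hsub U hUO) (hU.inter hO') s t hs ht k ⟨hk, hkO⟩
      ext v
      simp only [splitCov_apply, add_apply, map_add, add_sub_add_comm, hadd _ _ h1 h1',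
        hadd _ _ h2 h2', hadd _ _ h3 h3', smul_add, smul_sub]
      abel
    · rw [splitCov_of_eq_zero (hzero k hkO), splitCov_of_eq_zero (hzero k hkO),
        splitCov_of_eq_zero (hzero k hkO), hD.add U hUO hU s t hs ht k hk]
  · intro U hUO hU c s hs k hk v
    by_cases hkO : k ∈ O'
    · obtain ⟨h1, h2, h3⟩ := hproj U hU s hs
      have hsmul := fun s hs => hD.smul _ (hsub U hUO) (hU.inter hO') c s hs k ⟨hk, hkO⟩ v
      simp only [splitCov_apply, map_smul, ← smul_sub, hsmul _ h1, hsmul _ h2, hsmul _ h3]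
      simp only [smul_add, smul_sub, smul_comm c]
    · rw [splitCov_of_eq_zero (hzero k hkO), splitCov_of_eq_zero (hzero k hkO),
        hD.smul U hUO hU c s hs k hk]
  · intro U hUO hU f s hf hs k hk v
    by_cases hkO : k ∈ O'
    · obtain ⟨h1, h2, h3⟩ := hproj U hU s hs
      have hl := fun s hs => hD.leibniz _ (hsub U hUO) (hU.inter hO') f s
        (hf.mono inter_subset_left) hs k ⟨hk, hkO⟩ v
      simp only [splitCov_apply, ContinuousLinearMap.map_smul_of_tower, ← smul_sub, hl _ h1,
        hl _ h2, hl _ h3, map_add, map_sub, hQ.idem]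
      -- The terms in `df` recombine because `Q Q s + (1 - Q)(1 - Q) s = s` and the weights `1 - θ`
      -- and `θ` add up to `1`.
      module
    · rw [splitCov_of_eq_zero (hzero k hkO), splitCov_of_eq_zero (hzero k hkO),
        hD.leibniz U hUO hU f s hf hs k hk]
  · intro U hUO hU s t hs ht k hk v
    by_cases hkO : k ∈ O'
    · obtain ⟨h1, h2, h3⟩ := hproj U hU s hs
      obtain ⟨h1', h2', h3'⟩ := hproj U hU t ht
      have hu := fun s t hs ht => hD.unitary _ (hsub U hUO) (hU.inter hO') s t hs ht k ⟨hk, hkO⟩ v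
      have hadd := fun s t hs ht => hD.add _ (hsub U hUO) (hU.inter hO') s t hs ht k ⟨hk, hkO⟩
      have hexp : ((Real.exp (2 * V k) : ℝ) : ℂ) ≠ 0 := by
        exact_mod_cast (Real.exp_pos _).ne'
      have hs0 := hadd _ _ h2 h3
      have ht0 := hadd _ _ h2' h3'
      simp only [add_sub_cancel] at hs0 ht0
      have ho : ∀ k, ⟪Q k (s k), t k - Q k (t k)⟫_ℂ = 0 := fun k => by
        rw [hQ.symm, map_sub, hQ.idem, sub_self, inner_zero_right]
      have ho' : ∀ k, ⟪s k - Q k (s k), Q k (t k)⟫_ℂ = 0 := fun k => by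
        rw [← hQ.symm, map_sub, hQ.idem, sub_self, inner_zero_left]
      -- Metric compatibility applied to the orthogonal pairs `Q s`, `(1 - Q) t` and `(1 - Q) s`, `Q
      -- t` differentiates the zero function; the factor `e^{2V}` is then cancelled.
      have hc := hu _ _ h2 h3'
      have hc' := hu _ _ h3 h2'
      simp only [ho, ho', zero_mul] at hc hc'
      rw [diffAt_const, zero_apply, eq_comm, mul_eq_zero, or_iff_left hexp] at hc hc'
      have hsum : ⟪FiberedOp.splitCov θ Q D s k v, t k⟫_ℂ +
          ⟪s k, FiberedOp.splitCov θ Q D t k v⟫_ℂ = ⟪D s k v, t k⟫_ℂ + ⟪s k, D t k v⟫_ℂ := by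
        simp only [splitCov_apply, hs0, ht0, add_apply]
        exact inner_split_add_inner_split (hQ.symm k) hc hc'
      rw [hsum]
      exact hD.unitary U hUO hU s t hs ht k hk v
    · rw [splitCov_of_eq_zero (hzero k hkO), splitCov_of_eq_zero (hzero k hkO)]
      exact hD.unitary U hUO hU s t hs ht k hk v

/-- Where `θ = 1`, the projection `Q` is parallel for the split connection. -/
theorem parallelAt_splitCov_self (hD : IsUnitaryConnection 𝓑 O π V D) (hQ : IsSmoothProj 𝓑 O' Q)
    (hO : O'' ⊆ O) (hθ : θ k = 1) : ParallelAt 𝓑 O'' π (splitCov θ Q D) Q k := by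
  intro U hU hUo hk s _ v
  simp only [splitCov_apply, hQ.idem, sub_self, hD.apply_zero (hU.trans hO) hUo hk, hθ, map_add,
    ContinuousLinearMap.map_smul_of_tower]
  simp [hQ.idem]

/-- Splitting along `Q` does not change the compression of a connection to a subspace of the range
of `Q`. -/
theorem compress_splitCov_of_eq (hD : IsUnitaryConnection 𝓑 O π V D) (hUO : U ⊆ O) (hU : IsOpen U)
    (ht : 𝓑.SubSection π U t) (h : ∀ k ∈ U, Q k (t k) = t k) (hk : k ∈ U)
    (hP : ∀ x, P k (Q k x) = P k x) (v : TangentSpace 𝓘(ℝ, EuclideanSpace ℝ (Fin d)) k) :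
    P k (splitCov θ Q D t k v) = P k (D t k v) := by
  rw [splitCov_apply, hD.congr hUO hU ht h hk, hD.congr (s := fun k => t k - Q k (t k)) hUO hU .zero
    (fun k hk => by rw [h k hk, sub_self]) hk, hD.apply_zero hUO hU hk]
  simp only [map_add, ContinuousLinearMap.map_smul_of_tower, hP, zero_apply, map_zero, sub_self,
    add_zero]
  module

/-- Splitting along `Q` does not change the compression of a connection to a subspace of the kernel
of `Q`. -/
theorem compress_splitCov_of_eq_zero (hD : IsUnitaryConnection 𝓑 O π V D) (hUO : U ⊆ O)
    (hU : IsOpen U) (ht : 𝓑.SubSection π U t) (h : ∀ k ∈ U, Q k (t k) = 0) (hk : k ∈ U)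
    (hP : ∀ x, P k (Q k x) = 0) (v : TangentSpace 𝓘(ℝ, EuclideanSpace ℝ (Fin d)) k) :
    P k (splitCov θ Q D t k v) = P k (D t k v) := by
  rw [splitCov_apply, hD.congr hUO hU .zero h hk, hD.congr (s := fun k => t k - Q k (t k)) hUO hU ht
    (fun k hk => by rw [h k hk, sub_zero]) hk, hD.apply_zero hUO hU hk]
  simp only [map_add, map_sub, ContinuousLinearMap.map_smul_of_tower, hP, zero_apply, map_zero,
    sub_zero, zero_add]
  module

end FiberedOp

namespace FiberedOp

/-! ### Strata -/

section Strata

variable {d : ℕ} {M : Type*} [TopologicalSpace M] [ChartedSpace (EuclideanSpace ℝ (Fin d)) M]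
  {S S' : Set (M × ℝ)}

/-- Embedded submanifolds are locally closed. -/
theorem IsEmbeddedAnalytic.exists_isOpen (hS : IsEmbeddedAnalytic d S) {x : M × ℝ} (hx : x ∈ S) :
    ∃ O, IsOpen O ∧ x ∈ O ∧ closure S ∩ O ⊆ S := by
  obtain ⟨e, W, -, hxe, he⟩ := hS x hx
  refine ⟨e.source, e.open_source, hxe, fun y hy => (he y hy.2).2 ?_⟩
  have hy' : y ∈ closure (S ∩ e.source) := by
    rw [inter_comm]
    exact e.open_source.inter_closure ⟨hy.2, hy.1⟩
  have hc : ContinuousWithinAt (e.extend (prodModel d)) (S ∩ e.source) y :=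
    ((e.continuousOn_extend (I := prodModel d)) y (by rw [e.extend_source]; exact hy.2)).mono
      (by rw [e.extend_source]; exact inter_subset_right)
  have hW : IsClosed (W : Set (EuclideanSpace ℝ (Fin d) × ℝ)) := W.closed_of_finiteDimensional
  exact hW.closure_subset_iff.2 (by rintro _ ⟨z, hz, rfl⟩; exact (he z hz.2).1 hz.1)
    (hc.mem_closure_image hy')

/-- Two disjoint embedded submanifolds do not have the same closure. -/
theorem IsEmbeddedAnalytic.not_subset_closure (hS : IsEmbeddedAnalytic d S) (hne : S.Nonempty)
    (hdisj : Disjoint S S') (h : S ⊆ closure S') : ¬ S' ⊆ closure S := fun h' => by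
  obtain ⟨x, hx⟩ := hne
  obtain ⟨O, hO, hxO, hOS⟩ := hS.exists_isOpen hx
  obtain ⟨y, hyO, hy⟩ := mem_closure_iff.1 (h hx) O hO hxO
  exact hdisj.ne_of_mem (hOS ⟨h' hy, hyO⟩) hy rfl

end Strata

/-! ### Cut-off functions -/

theorem exists_contMDiff_eq_one_tsupport_subset {d : ℕ} {M : Type*} [TopologicalSpace M]
    [ChartedSpace (EuclideanSpace ℝ (Fin d)) M] [T2Space M] [SecondCountableTopology M]
    [IsManifold 𝓘(ℝ, EuclideanSpace ℝ (Fin d)) ∞ M] {K O : Set M} (hK : IsClosed K)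
    (hO : IsOpen O) (hKO : K ⊆ O) :
    ∃ θ : M → ℝ, ContMDiff 𝓘(ℝ, EuclideanSpace ℝ (Fin d)) 𝓘(ℝ, ℝ) ∞ θ ∧ (∀ k ∈ K, θ k = 1) ∧
      tsupport θ ⊆ O := by
  have : LocallyCompactSpace M := ChartedSpace.locallyCompactSpace (EuclideanSpace ℝ (Fin d)) M
  obtain ⟨f, h0, h1, -⟩ := exists_contMDiffMap_zero_one_nhds_of_isClosed (n := ⊤)
    𝓘(ℝ, EuclideanSpace ℝ (Fin d)) hO.isClosed_compl hK (disjoint_compl_left_iff_subset.2 hKO)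
  refine ⟨f, f.contMDiff, fun k hk => (h1.self_of_nhdsSet k hk), fun k hk => ?_⟩
  by_contra hkO
  exact notMem_tsupport_iff_eventuallyEq.2 (h0.filter_mono (nhds_le_nhdsSet hkO)) hk

theorem isCompact_charVarietyOver {d : ℕ} {M : Type*} [TopologicalSpace M]
    [ChartedSpace (EuclideanSpace ℝ (Fin d)) M] {F : M → Type*} [∀ k, NormedAddCommGroup (F k)]
    [∀ k, InnerProductSpace ℂ (F k)] [∀ k, CompleteSpace (F k)] {H' : Type*}
    [NormedAddCommGroup H'] [InnerProductSpace ℂ H'] {𝓑 : HilbertBundle d F H'}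
    {H₀ : ∀ k, F k →ₗ.[ℂ] F k} (hH : IsAnalyticallyFibered 𝓑 H₀) {A : Set ℝ}
    (hA : IsCompact A) : IsCompact (charVarietyOver H₀ A) := by
  have h := (hH.proper.isCompact_preimage hA).image continuous_subtype_val
  convert h using 1
  ext x
  simp only [charVarietyOver, mem_ofPred_eq, mem_image, mem_preimage, Subtype.exists,
    exists_and_left, exists_prop, exists_eq_right_right]
  exact and_comm

/-! ### The projections of an adapted covering -/

namespace AdaptedCovering

variable {d : ℕ} {M : Type*} [TopologicalSpace M] [ChartedSpace (EuclideanSpace ℝ (Fin d)) M]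
  [IsManifold 𝓘(ℝ, EuclideanSpace ℝ (Fin d)) ω M] [MeasurableSpace M]
  {F : M → Type*} [∀ k, NormedAddCommGroup (F k)] [∀ k, InnerProductSpace ℂ (F k)]
  [∀ k, CompleteSpace (F k)] {H' : Type*} [NormedAddCommGroup H'] [InnerProductSpace ℂ H']
  {𝓑 : HilbertBundle d F H'} {H₀ : ∀ k, F k →ₗ.[ℂ] F k} {ν : Measure M}
  {𝒮 : Set (Set (M × ℝ))} {I I' : Set ℝ} (C : AdaptedCovering 𝓑 H₀ ν 𝒮 I I')

theorem proj_comm (hH : IsAnalyticallyFibered 𝓑 H₀) (p q : C.Pairs) (k : M) (x : F k) :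
    C.proj p k (C.proj q k x) = C.proj q k (C.proj p k x) :=
  spectralProj_comm (hH.selfAdjoint k) _ _ x

/-- The identity `π = W W^*` is what transfers smoothness from the frame to the projection. -/
theorem proj_apply_eq_frame (p : C.Pairs) {k : M} (hk : k ∈ C.dom p.1) (x : F k) :
    C.proj p k x = C.W p k (ContinuousLinearMap.adjoint (C.W p k) x) := by
  have hr : ∀ y, C.proj p k y ∈
      LinearMap.range (C.W p k : EuclideanSpace ℂ (Fin (C.μ p)) →ₗ[ℂ] F k) := fun y => by
    rw [C.W_range p k hk]
    exact ⟨y, rfl⟩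
  rw [← apply_adjoint_of_mem_range (C.W_isometry p k hk) (hr x)]
  congr 1
  refine ext_inner_left ℂ fun c => ?_
  have hc : C.proj p k (C.W p k c) = C.W p k c := by
    refine mem_range_spectralProj.1 ?_
    rw [← C.W_range p k hk]
    exact ⟨c, rfl⟩
  rw [ContinuousLinearMap.adjoint_inner_right, ContinuousLinearMap.adjoint_inner_right, proj,
    ← inner_spectralProj_left]
  exact congrArg (⟪·, x⟫_ℂ) hc

theorem isSmoothProj (p : C.Pairs) : IsSmoothProj 𝓑 (C.dom p.1) (C.proj p) where
  idem k := spectralProj_idem (H₀ k) (C.J p)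
  symm k := inner_spectralProj_left (H₀ k) (C.J p)
  smooth U hUO hU s hs := by
    have hW : 𝓑.FrameAnalyticOn U (C.W p) := fun i =>
      (C.W_analytic p i).mono (inter_subset_inter_left _ hUO)
    exact (hW.smoothOn_apply (hW.contMDiffOn_adjoint_apply hU hs)).congr fun k hk =>
      C.proj_apply_eq_frame p (hUO hk) _

theorem isUnitaryConnection_nabla (p : C.Pairs) :
    IsUnitaryConnection 𝓑 (C.dom p.1) (C.proj p) (C.V p.1) (C.nabla p) :=
  isUnitaryConnection_frameCov (C.W_analytic p) (C.W_isometry p) (C.W_range p)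
    (((C.V_density p.1).1.mono (C.dom_subset p.1)).of_le le_top)

/-- The field `maps` tests a connection on smooth vector fields only; this version handles a single
tangent vector without extending it to a field. -/
theorem preservesFibers_nabla (p : C.Pairs) :
    PreservesFibers 𝓑 (C.dom p.1) (C.proj p) (C.nabla p) :=
  fun _ hU _ _ hs _ hk v => frameCov_mem_range (C.W_range p) hU hs hk v

/-- An eigenvector for `l ∈ J` is fixed by `1_J(H₀) = 1_{J'}(H₀)`, which would kill it if `l ∉ J'`.
Consequently `χ` takes only the values `0` and `1` on the spectrum over `ω_m`. -/
theorem mem_J'_of_mem_charVariety (hH : IsAnalyticallyFibered 𝓑 H₀) (p : C.Pairs) {k : M} {l : ℝ}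
    (hkl : (k, l) ∈ charVariety H₀) (hk : k ∈ C.dom p.1) (hl : l ∈ C.J p) : l ∈ C.J' p := by
  obtain ⟨R, hR, hc, -⟩ := hH.resolvent
  obtain ⟨x, hx, hx0⟩ :=
    exists_mem_eigenspace_of_mem_pmapSpectrum (hH.selfAdjoint k) (hR k) (hc k) hkl
  by_contra hl'
  have h := spectralProj_apply_of_mem hl hx
  rw [C.J'_proj p k hk, spectralProj_apply_of_notMem (hH.selfAdjoint k) hl' hx] at h
  exact hx0 h.symm

variable {C} (P : C.PartitionOfUnity)

namespace PartitionOfUnity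

theorem χ_eq_indicator (hH : IsAnalyticallyFibered 𝓑 H₀) (p : C.Pairs) {k : M} {l : ℝ}
    (hkl : (k, l) ∈ charVariety H₀) (hk : k ∈ C.dom p.1) :
    P.χ p l = (C.J p).indicator 1 l := by
  by_cases hl : l ∈ C.J p
  · rw [indicator_of_mem hl, Pi.one_apply]
    exact (P.χ_eq_one p).self_of_nhdsSet l
      (subset_closure (C.mem_J'_of_mem_charVariety hH p hkl hk hl))
  · rw [indicator_of_notMem hl]
    exact image_eq_zero_of_notMem_tsupport fun h => hl (P.χ_support p h)

/-- Over the support of `g m`, the intervals `J (m, n)` cover the part of the spectrum which lies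
in the closure of `I`. -/
theorem exists_mem_J (hH : IsAnalyticallyFibered 𝓑 H₀) {k₀ : M} {l₀ : ℝ}
    (h₀ : (k₀, l₀) ∈ charVarietyOver H₀ (closure I)) {m : Fin C.num}
    (hm : k₀ ∈ tsupport (P.g m)) : ∃ n, l₀ ∈ C.J ⟨m, n⟩ := by
  by_contra! hn
  refine notMem_tsupport_iff_eventuallyEq.2 ?_ hm
  have h1 : ∀ᶠ k in 𝓝 k₀, ∑ m, P.g m k ^ 2 = 1 :=
    P.sum_g.filter_mono (nhds_le_nhdsSet (mem_image_of_mem Prod.fst h₀))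
  have h2 : ∀ᶠ k in 𝓝 k₀, ∑ p : C.Pairs, P.g p.1 k ^ 2 * P.χ p l₀ ^ 2 = 1 :=
    (Continuous.prodMk_left l₀).continuousAt.eventually
      (P.sum_gχ.filter_mono (nhds_le_nhdsSet h₀))
  have h3 : ∀ᶠ k in 𝓝 k₀, ∀ m, k₀ ∉ tsupport (P.g m) → P.g m k = 0 :=
    eventually_all.2 fun m => by
      by_cases h : k₀ ∈ tsupport (P.g m)
      · simp [h]
      · filter_upwards [notMem_tsupport_iff_eventuallyEq.1 h] with k hk _ using hk
  filter_upwards [h1, h2, h3] with k hk1 hk2 hk3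
  -- This is the difference of the two partition identities. Its terms are nonnegative: by
  -- disjointness at most one `χ (m, n)` equals `1` at `l₀`, the others being `0`. So each term
  -- vanishes, and if no `J (m, n)` contained `l₀`, then `g m` would vanish near `k₀`.
  have hsum : ∑ m, P.g m k ^ 2 * (1 - ∑ n, P.χ ⟨m, n⟩ l₀ ^ 2) = 0 := by
    simp only [mul_sub, mul_one, Finset.sum_sub_distrib, hk1, Finset.mul_sum]
    rw [← hk2, Fintype.sum_sigma, sub_self]
  have hnonneg : ∀ m ∈ Finset.univ, 0 ≤ P.g m k ^ 2 * (1 - ∑ n, P.χ ⟨m, n⟩ l₀ ^ 2) := by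
    intro m _
    by_cases hm' : k₀ ∈ tsupport (P.g m)
    · refine mul_nonneg (sq_nonneg _) (sub_nonneg.2 ?_)
      have hχ := fun n => P.χ_eq_indicator hH ⟨m, n⟩ h₀.1 (P.g_support m hm')
      simp only [hχ]
      by_cases hex : ∃ n, l₀ ∈ C.J ⟨m, n⟩
      · obtain ⟨n, hnl⟩ := hex
        rw [Finset.sum_eq_single n]
        · simp [hnl]
        · intro n' _ hne
          have : l₀ ∉ C.J ⟨m, n'⟩ := fun h => (C.J_disjoint m n' n hne).ne_of_mem h hnl rfl
          simp [this]
        · simp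
      · push Not at hex
        simp [hex]
    · simp [hk3 m hm']
  have h := (Finset.sum_eq_zero_iff_of_nonneg hnonneg).1 hsum m (Finset.mem_univ m)
  have hχ : ∀ n, P.χ ⟨m, n⟩ l₀ = 0 := fun n => by
    rw [P.χ_eq_indicator hH ⟨m, n⟩ h₀.1 (P.g_support m hm), indicator_of_notMem (hn n)]
  simpa [hχ] using h

/-- Cut-off functions equal to `1` on the support of `g m`, with support so small that the
intervals `J (m, n)` still cover the relevant part of the spectrum there. -/
theorem exists_cutoff [T2Space M] [SecondCountableTopology M]
    (hH : IsAnalyticallyFibered 𝓑 H₀) (hI : IsCompact (closure I)) (m : Fin C.num) :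
    ∃ θ : M → ℝ, ContMDiff 𝓘(ℝ, EuclideanSpace ℝ (Fin d)) 𝓘(ℝ, ℝ) ∞ θ ∧
      (∀ k ∈ tsupport (P.g m), θ k = 1) ∧ tsupport θ ⊆ C.dom m ∧
      ∀ k l, (k, l) ∈ charVarietyOver H₀ (closure I) → k ∈ tsupport θ → ∃ n, l ∈ C.J ⟨m, n⟩ := by
  -- `B` collects the points above which the `J (m, n)` miss some spectrum in `closure I`. It is
  -- compact by properness and avoids `supp g_m` by `exists_mem_J`, so the cut-off can be supported
  -- in `ω_m \ B`.
  set B : Set M := Prod.fst '' (charVarietyOver H₀ (closure I) ∩ ⋂ n, {x | x.2 ∉ C.J ⟨m, n⟩})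
  have hB : IsClosed B := by
    refine (((isCompact_charVarietyOver hH hI).inter_right (isClosed_iInter fun n => ?_)).image
      continuous_fst).isClosed
    exact (((C.J_interval ⟨m, n⟩).1.preimage continuous_snd).isClosed_compl)
  obtain ⟨θ, h1, h2, h3⟩ := exists_contMDiff_eq_one_tsupport_subset (d := d)
    (isClosed_tsupport (P.g m)) ((C.isOpen_dom m).sdiff hB) (fun k hk => ⟨P.g_support m hk, by
      rintro ⟨⟨k, l⟩, ⟨hkl, hl⟩, rfl⟩
      obtain ⟨n, hn⟩ := P.exists_mem_J hH hkl hk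
      exact mem_iInter.1 hl n hn⟩)
  refine ⟨θ, h1, h2, h3.trans sdiff_subset, fun k l hkl hk => ?_⟩
  by_contra! hn
  exact (h3 hk).2 ⟨(k, l), ⟨hkl, mem_iInter.2 hn⟩, rfl⟩

end PartitionOfUnity

variable (C)

/-- If the closures of the strata `S p`, `S q` of two cylinders which meet over `Σ` are nested,
then so are the ranges of the projections. -/
theorem proj_comp_proj_of_closure_subset (h𝒮 : IsStratification d H₀ 𝒮) {p q : C.Pairs}
    (hpq : (C.cyl p ∩ C.cyl q ∩ charVariety H₀).Nonempty)
    (hS : closure (C.S p) ⊆ closure (C.S q)) {k : M} (hp : k ∈ C.dom p.1) (hq : k ∈ C.dom q.1)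
    (x : F k) : C.proj p k (C.proj q k x) = C.proj q k x := by
  rcases le_or_gt (C.μ q) (C.μ p) with hμ | hμ
  · exact DFunLike.congr_fun (C.overlap_proj p q hpq hμ k ⟨hp, hq⟩) x
  -- If `μ p < μ q`, the overlap condition with roles exchanged leaves only `S q ⊆ ∂ (S p)`.
  -- Together with the nesting of closures, the disjoint strata `S p` and `S q` would each lie in
  -- the closure of the other.
  · exfalso
    have hqp : (C.cyl q ∩ C.cyl p ∩ charVariety H₀).Nonempty := by
      rwa [inter_comm (C.cyl q)]
    rcases C.overlap_strata q p hqp hμ.le with h | h | h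
    · refine (h𝒮.embedded _ (C.S_mem p).1).not_subset_closure
        ((C.S_meets p).mono inter_subset_left) ?_ (subset_closure.trans hS) (h.trans sdiff_subset)
      exact disjoint_left.2 fun x hx hx' => (h hx').2 hx
    · exact hμ.ne' h.2
    · exact hμ.ne' h.2

/-- The connection obtained from `∇^p` by splitting it successively along projections. -/
noncomputable def splitNabla (θ : Fin C.num → M → ℝ) (p : C.Pairs) : List C.Pairs → Cov d F
  | [] => C.nabla p
  | q :: l => splitCov (θ q.1) (C.proj q) (splitNabla θ p l)

variable {C} {θ : Fin C.num → M → ℝ}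

theorem splitNabla_spec (hH : IsAnalyticallyFibered 𝓑 H₀)
    (hθs : ∀ m, ContMDiff 𝓘(ℝ, EuclideanSpace ℝ (Fin d)) 𝓘(ℝ, ℝ) ∞ (θ m))
    (hθ : ∀ m, tsupport (θ m) ⊆ C.dom m) (p : C.Pairs) (l : List C.Pairs) :
    IsUnitaryConnection 𝓑 (C.dom p.1) (C.proj p) (C.V p.1) (C.splitNabla θ p l) ∧
      PreservesFibers 𝓑 (C.dom p.1) (C.proj p) (C.splitNabla θ p l) := by
  induction l with
  | nil => exact ⟨C.isUnitaryConnection_nabla p, C.preservesFibers_nabla p⟩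
  | cons q l ih =>
    exact ⟨ih.1.splitCov ih.2 (C.isSmoothProj q) (C.isOpen_dom q.1) (hθ q.1) (hθs q.1)
      (C.proj_comm hH q p), ih.2.splitCov (C.isSmoothProj q) (C.isOpen_dom q.1) (hθ q.1)
      (C.proj_comm hH q p)⟩

/-- The head of the list is the last splitting performed. `π_q` becomes parallel at its own turn and
remains so afterwards, because the projections commute. -/
theorem parallelAt_splitNabla (hH : IsAnalyticallyFibered 𝓑 H₀)
    (hθs : ∀ m, ContMDiff 𝓘(ℝ, EuclideanSpace ℝ (Fin d)) 𝓘(ℝ, ℝ) ∞ (θ m))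
    (hθ : ∀ m, tsupport (θ m) ⊆ C.dom m) (p q : C.Pairs) {k : M} (hk : θ q.1 k = 1)
    {l : List C.Pairs} (hq : q ∈ l) :
    ParallelAt 𝓑 (C.dom p.1) (C.proj p) (C.splitNabla θ p l) (C.proj q) k := by
  induction l with
  | nil => simp at hq
  | cons q' l ih =>
    rcases List.mem_cons.1 hq with rfl | hq
    · exact parallelAt_splitCov_self (splitNabla_spec hH hθs hθ p l).1 (C.isSmoothProj q)
        Subset.rfl hk
    · exact (ih hq).splitCov (C.isSmoothProj q') (C.isOpen_dom q'.1) (hθ q'.1)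
        (C.proj_comm hH q' p) (C.proj_comm hH q' q)

/-- Under each alternative of `hq`, a splitting along `π_q` acts trivially on the compression to
`π_r`; `hpr` ensures that `π_r s` is a section of `π_p F`, to which the connection applies. -/
theorem compress_splitNabla (hH : IsAnalyticallyFibered 𝓑 H₀)
    (hθs : ∀ m, ContMDiff 𝓘(ℝ, EuclideanSpace ℝ (Fin d)) 𝓘(ℝ, ℝ) ∞ (θ m))
    (hθ : ∀ m, tsupport (θ m) ⊆ C.dom m) (p r : C.Pairs) {U : Set M} (hU : IsOpen U)
    (hUp : U ⊆ C.dom p.1) (hUr : U ⊆ C.dom r.1)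
    (hpr : ∀ k ∈ U, ∀ x, C.proj p k (C.proj r k x) = C.proj r k x)
    (hq : ∀ q : C.Pairs, (∀ k ∈ U, θ q.1 k = 0) ∨
      (∀ k ∈ U, ∀ x, C.proj q k (C.proj r k x) = C.proj r k x) ∨
      ∀ k ∈ U, ∀ x, C.proj q k (C.proj r k x) = 0)
    {s : ∀ k, F k} (hs : 𝓑.SmoothOn U s) {k : M} (hk : k ∈ U)
    (v : TangentSpace 𝓘(ℝ, EuclideanSpace ℝ (Fin d)) k) (l : List C.Pairs) :
    C.proj r k (C.splitNabla θ p l (fun k => C.proj r k (s k)) k v) =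
      C.proj r k (C.nabla p (fun k => C.proj r k (s k)) k v) := by
  have ht : 𝓑.SubSection (C.proj p) U (fun k => C.proj r k (s k)) :=
    ⟨(C.isSmoothProj r).smooth U hUr hU s hs, fun k hk => ⟨_, hpr k hk (s k)⟩⟩
  induction l with
  | nil => rfl
  | cons q l ih =>
    refine Eq.trans ?_ ih
    have hD := (splitNabla_spec hH hθs hθ p l).1
    rcases hq q with h | h | h
    · rw [splitNabla, splitCov_of_eq_zero (h k hk)]
    · exact compress_splitCov_of_eq hD hUp hU ht (fun k hk => h k hk _) hk
        (fun x => by rw [C.proj_comm hH, h k hk]) v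
    · exact compress_splitCov_of_eq_zero hD hUp hU ht (fun k hk => h k hk _) hk
        (fun x => by rw [C.proj_comm hH, h k hk]) v

end AdaptedCovering

end FiberedOp

/-! ### Construction of the connections -/

open FiberedOp in
theorem mainTheorem2 {d : ℕ} {M : Type*} [TopologicalSpace M] [T2Space M]
    [SecondCountableTopology M] [ChartedSpace (EuclideanSpace ℝ (Fin d)) M]
    [IsManifold 𝓘(ℝ, EuclideanSpace ℝ (Fin d)) ω M] [MeasurableSpace M] [BorelSpace M]
    {H' : Type*} [NormedAddCommGroup H'] [InnerProductSpace ℂ H'] [CompleteSpace H']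
    {F : M → Type*} [∀ k, NormedAddCommGroup (F k)] [∀ k, InnerProductSpace ℂ (F k)]
    [∀ k, CompleteSpace (F k)]
    (𝓑 : HilbertBundle d F H') (H₀ : ∀ k, F k →ₗ.[ℂ] F k) (hH : IsAnalyticallyFibered 𝓑 H₀)
    (ν : Measure M) (hν : IsAnalyticDensity d ν)
    (𝒮 : Set (Set (M × ℝ))) (h𝒮 : IsStratification d H₀ 𝒮)
    (I I' : Set ℝ) (hI : IsOpenInterval I) (hI' : IsOpenInterval I') (hII' : CompactlyIn I I')
    (hτ : I' ⊆ (thresholds d 𝒮)ᶜ)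
    (C : AdaptedCovering 𝓑 H₀ ν 𝒮 I I') (P : C.PartitionOfUnity) :
    ∃ D : C.Pairs → Cov d F,
      -- each `D p` is a unitary connection on `π_p F → ω_m`, for `p = (m, n)`
      (∀ p, IsUnitaryConnection 𝓑 (C.dom p.1) (C.proj p) (C.V p.1) (D p)) ∧
      -- `D p (π_p π_q) = 0` above `supp g_m ∩ supp g_m'`, for `p = (m, n)` and `q = (m', n')`
      (∀ p q, ∀ U ⊆ C.dom p.1 ∩ C.dom q.1, IsOpen U → ∀ s, 𝓑.SubSection (C.proj p) U s →
        ∀ k ∈ U ∩ (tsupport (P.g p.1) ∩ tsupport (P.g q.1)), ∀ v,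
          endCov (D p) (fun k => C.proj p k ∘L C.proj q k) s k v = 0) ∧
      -- near `k₀`, the compressions of `D p` and of the original connection coincide
      (∀ p (k₀ : M) (l₀ : ℝ), (k₀, l₀) ∈ C.cyl p ∩ charVarietyOver H₀ (closure I) →
        ∀ (L : ℕ) (c : Fin (L + 1) → C.Pairs),
          Set.range c = {q | (k₀, l₀) ∈ C.cyl q} →
          (∀ j : Fin L, closure (C.S (c j.castSucc)) ⊆ closure (C.S (c j.succ))) →
          ∃ 𝒱 : Set M, IsOpen 𝒱 ∧ k₀ ∈ 𝒱 ∧ 𝒱 ⊆ C.dom p.1 ∩ C.dom (c (Fin.last L)).1 ∧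
            ∀ U ⊆ 𝒱, IsOpen U → ∀ s, 𝓑.SmoothOn U s → ∀ k ∈ U, ∀ v,
              C.proj (c (Fin.last L)) k (D p (fun k => C.proj (c (Fin.last L)) k (s k)) k v) =
              C.proj (c (Fin.last L)) k
                (C.nabla p (fun k => C.proj (c (Fin.last L)) k (s k)) k v)) := by
  classical
  have hIc : IsCompact (closure I) := hII'.1
  choose θ hθs hθ1 hθ hθJ using fun m => P.exists_cutoff hH hIc m
  refine ⟨fun p => C.splitNabla θ p Finset.univ.toList, fun p =>
    (AdaptedCovering.splitNabla_spec hH hθs hθ p _).1, ?_, ?_⟩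
  · intro p q U hU hUo s hs k hk v
    obtain ⟨hD, hF⟩ := AdaptedCovering.splitNabla_spec hH hθs hθ p Finset.univ.toList
    have hpar := AdaptedCovering.parallelAt_splitNabla hH hθs hθ p q
      (hθ1 q.1 k hk.2.2) (Finset.mem_toList.2 (Finset.mem_univ q))
    have hUp : U ⊆ C.dom p.1 := hU.trans inter_subset_left
    have hfix : ∀ k, ∀ x ∈ LinearMap.range (C.proj p k : F k →ₗ[ℂ] F k), C.proj p k x = x :=
      fun k x hx => mem_range_spectralProj.1 hx
    have hs' : 𝓑.SubSection (C.proj p) U (fun k => C.proj q k (s k)) :=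
      hs.proj (C.isSmoothProj q) (C.proj_comm hH q p) (hU.trans inter_subset_right) hUo
    -- On sections of `π_p F`, `π_p π_q` acts as `π_q`, since `π_q` preserves the range of `π_p`.
    have hcongr : C.splitNabla θ p Finset.univ.toList
        (fun k => (C.proj p k ∘L C.proj q k) (s k)) k =
        C.splitNabla θ p Finset.univ.toList (fun k => C.proj q k (s k)) k :=
      hD.congr hUp hUo hs' (fun k hk => hfix k _ (hs'.2 k hk)) hk.1
    rw [endCov]
    beta_reduce
    rw [hcongr, hpar U hUp hUo hk.1 s hs v, ContinuousLinearMap.comp_apply,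
      C.proj_comm hH, hfix k _ (hF U hUp hUo s hs k hk.1 v), sub_self]
  · intro p k₀ l₀ h₀ L c hc hchain
    have hmem : ∀ j, (k₀, l₀) ∈ C.cyl (c j) := fun j =>
      (hc.subset (mem_range_self j) : c j ∈ {q | (k₀, l₀) ∈ C.cyl q})
    have hlast : ∀ j, closure (C.S (c j)) ⊆ closure (C.S (c (Fin.last L))) :=
      fun j => (Fin.monotone_iff_le_succ.2 hchain : Monotone fun j => closure (C.S (c j)))
        (Fin.le_last j)
    set r := c (Fin.last L)
    have hle : ∀ q, (k₀, l₀) ∈ C.cyl q → ∀ k ∈ C.dom q.1, k ∈ C.dom r.1 → ∀ x,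
        C.proj q k (C.proj r k x) = C.proj r k x := by
      intro q hq k hkq hkr x
      obtain ⟨j, rfl⟩ : q ∈ Set.range c := hc.superset hq
      exact C.proj_comp_proj_of_closure_subset h𝒮 ⟨_, ⟨hq, hmem _⟩, h₀.2.1⟩ (hlast j) hkq hkr x
    -- For each `m` the neighbourhood lies either in `ω_m` or off `supp θ_m`, according to the
    -- position of `k₀`.
    refine ⟨(C.dom p.1 ∩ C.dom r.1) ∩
      ⋂ m, (if k₀ ∈ tsupport (θ m) then C.dom m else (tsupport (θ m))ᶜ), ?_, ?_,
      inter_subset_left, ?_⟩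
    · refine ((C.isOpen_dom _).inter (C.isOpen_dom _)).inter (isOpen_iInter_of_finite fun m => ?_)
      split_ifs
      · exact C.isOpen_dom m
      · exact (isClosed_tsupport _).isOpen_compl
    · refine ⟨⟨h₀.1.1, (hmem (Fin.last L)).1⟩, mem_iInter.2 fun m => ?_⟩
      split_ifs with h
      · exact hθ m h
      · exact h
    · intro U hU hUo s hs k hk v
      have hUp : U ⊆ C.dom p.1 := fun k hk => (hU hk).1.1
      have hUr : U ⊆ C.dom r.1 := fun k hk => (hU hk).1.2
      refine AdaptedCovering.compress_splitNabla hH hθs hθ p r hUo hUp hUr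
        (fun k hk => hle p h₀.1 k (hUp hk) (hUr hk)) (fun q => ?_) hs hk v _
      by_cases hq : k₀ ∈ tsupport (θ q.1)
      · have hUq : U ⊆ C.dom q.1 := fun k hk => by
          have := mem_iInter.1 (hU hk).2 q.1
          rwa [if_pos hq] at this
        -- `n` is the index for which the cylinder `(m, n)`, with the same `m` as `q`, contains
        -- `(k₀, l₀)`. Then `π_q π_r = π_r` if `q = (m, n)`; otherwise `π_q π_r = π_q π_{m,n} π_r =
        -- 0`.
        obtain ⟨n, hn⟩ := hθJ q.1 k₀ l₀ h₀.2 hq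
        have hle' := hle ⟨q.1, n⟩ ⟨hθ q.1 hq, hn⟩
        by_cases hqn : q.2 = n
        · subst hqn
          exact .inr (.inl fun k hk => hle' k (hUq hk) (hUr hk))
        · refine .inr (.inr fun k hk x => ?_)
          rw [← hle' k (hUq hk) (hUr hk) x]
          exact spectralProj_apply_eq_zero_of_disjoint (hH.selfAdjoint k)
            (C.J_disjoint q.1 q.2 n hqn) _
      · refine .inl fun k hk => image_eq_zero_of_notMem_tsupport ?_
        have := mem_iInter.1 (hU hk).2 q.1
        rwa [if_neg hq] at this
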